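/- **Theorem 3.1.** Let $(R,\mathfrak m)$ be a commutative Noetherian local ring, let $M\neq 0$ be a finitely generated Cohen–Macaulay $R$-module of Krull dimension $d$, and let $\underline{x}=(x_1,\ldots,x_d)$ be a system of parameters for $M$ (that is, $x_1,\ldots,x_d\in\mathfrak m$ and $M/(x_1,\ldots,x_d)M$ has finite length). For an $R$-module $X$ and $i\ge 0$ let $$H_i^{\underline{x}}(X)=\varprojlim_{n\ge 1} H_i\bigl(K_\bullet(x_1^n,\ldots,x_d^n;X)\bigr)$$ denote the $i$-th local homology module of $X$ with respect to $\underline{x}$, where $K_\bullet(x_1^n,\ldots,x_d^n;X)$ is the Koszul complex and the transition maps are induced by the chain maps $K_\bullet(x_1^{n+1},\ldots,x_d^{n+1};X)\to K_\bullet(x_1^{n},\ldots,x_d^{n};X)$, $m\,e_{s_1}\wedge\cdots\wedge e_{s_i}\mapsto x_{s_1}\cdots x_{s_i}m\,e_{s_1}\wedge\cdots\wedge e_{s_i}$. Let $H^j_{\mathfrak m}(M)$ be the $j$-th local cohomology module of $M$ with support in $\mathfrak m$. Then for all $i,j\ge 0$ there is an isomorphism of $R$-modules $$H_i^{\underline{x}}\bigl(H^j_{\mathfrak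 m}(M)\bigr)\cong\begin{cases}\widehat{M} & \text{if } i=j=d,\\ 0 & \text{otherwise,}\end{cases}$$ where $\widehat{M}=\varprojlim_n M/\mathfrak m^nM$ is the $\mathfrak m$-adic completion of $M$. -/

import Mathlib

open CategoryTheory CategoryTheory.Limits

universe u v

noncomputable section

namespace LocalHomology

section Modules

variable (R : Type u) [CommRing R] [IsLocalRing R] (M : Type v) [AddCommGroup M] [Module R M]

/-- The depth of a module over a local ring: the supremum of the lengths of the `M`-regular
sequences of elements of the maximal ideal. -/
def depth : ℕ∞ :=
  ⨆ rs : {rs : List R // (∀ r ∈ rs, r ∈ IsLocalRing.maximalIdeal R) ∧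
    RingTheory.Sequence.IsRegular M rs}, (rs.1.length : ℕ∞)

/-- A (finitely generated) module over a (Noetherian) local ring is Cohen–Macaulay if it is zero
or its depth equals its Krull dimension. -/
def IsCohenMacaulay : Prop :=
  Subsingleton M ∨ ((depth R M : ℕ∞) : WithBot ℕ∞) = Module.supportDim R M

variable {R}

/-- `x₁, …, x_d` is a system of parameters for `M`: the `xᵢ` lie in the maximal ideal,
`d = dim M`, and `M / (x₁, …, x_d) M` has finite length. -/
structure IsSystemOfParameters {d : ℕ} (x : Fin d → R) : Prop where
  mem_maximalIdeal : ∀ s, x s ∈ IsLocalRing.maximalIdeal R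
  supportDim_eq : Module.supportDim R M = d
  isFiniteLength : IsFiniteLength R (M ⧸ Ideal.span (Set.range x) • (⊤ : Submodule R M))

end Modules

section Koszul

variable {R : Type u} [CommRing R] {r : ℕ}

/-- The degree `i` part of the Koszul complex of `X` with respect to `r` elements: a direct sum of
copies of `X`, one for each basis vector `e_S = e_{s₁} ∧ ⋯ ∧ e_{sᵢ}`, where
`S = {s₁ < ⋯ < sᵢ}` is an `i`-element subset of the index set. -/
abbrev KoszulX (r : ℕ) (X : Type v) (i : ℕ) : Type v :=
  {S : Finset (Fin r) // S.card = i} → X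

/-- `S ∪ {s}`, for an element `s` outside the `i`-element subset `S`. -/
def insertIndex {i : ℕ} (S : {S : Finset (Fin r) // S.card = i}) (s : {s // s ∉ S.1}) :
    {S : Finset (Fin r) // S.card = i + 1} :=
  ⟨insert s.1 S.1, by rw [Finset.card_insert_of_notMem s.2, S.2]⟩

/-- The sign with which `e_S` occurs in the boundary of `e_{S ∪ {s}}`: `(-1)` to the number of
elements of `S` that precede `s`. -/
def koszulSign (S : Finset (Fin r)) (s : Fin r) : R :=
  (-1) ^ (S.filter (· < s)).card

variable (x : Fin r → R) (X : Type v) [AddCommGroup X] [Module R X]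

/-- The Koszul differential
`∂ (m e_{s₀} ∧ ⋯ ∧ e_{sᵢ}) = ∑ₖ (-1)ᵏ x_{sₖ} m e_{s₀} ∧ ⋯ ∧ ê_{sₖ} ∧ ⋯ ∧ e_{sᵢ}`,
written out in coordinates. -/
def koszulD (i : ℕ) : KoszulX r X (i + 1) →ₗ[R] KoszulX r X i where
  toFun f S := ∑ s : {s // s ∉ S.1}, (koszulSign S.1 s.1 * x s.1) • f (insertIndex S s)
  map_add' f g := by
    funext S
    simp [smul_add, Finset.sum_add_distrib]
  map_smul' a f := by
    funext S
    simp only [Pi.smul_apply, RingHom.id_apply, Finset.smul_sum]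
    exact Finset.sum_congr rfl fun s _ => smul_comm _ _ _

theorem koszulSign_insert (S : Finset (Fin r)) {s t : Fin r} (hs : s ∉ S) (ht : t ∉ S)
    (hst : s ≠ t) :
    (koszulSign S s * koszulSign (insert s S) t : R) =
      -(koszulSign S t * koszulSign (insert t S) s) := by
  unfold koszulSign
  rcases lt_or_gt_of_ne hst with h | h
  · rw [Finset.filter_insert, Finset.filter_insert, if_pos h, if_neg (not_lt.2 h.le),
      Finset.card_insert_of_notMem (by simp [hs])]
    ring
  · rw [Finset.filter_insert, Finset.filter_insert, if_neg (not_lt.2 h.le), if_pos h,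
      Finset.card_insert_of_notMem (by simp [ht])]
    ring

theorem koszulD_comp (i : ℕ) : koszulD x X i ∘ₗ koszulD x X (i + 1) = 0 := by
  apply LinearMap.ext
  intro f
  funext S
  simp only [LinearMap.comp_apply, koszulD, LinearMap.coe_mk, AddHom.coe_mk, Finset.smul_sum,
    LinearMap.zero_apply, Pi.zero_apply]
  rw [Finset.sum_sigma']
  have key : ∀ a : (s : {s // s ∉ S.1}) × {t // t ∉ (insertIndex S s).1},
      a.2.1 ∉ S.1 ∧ a.2.1 ≠ a.1.1 := fun a => by
    have := a.2.2
    simp only [insertIndex, Finset.mem_insert, not_or] at this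
    exact ⟨this.2, this.1⟩
  refine Finset.sum_involution (fun a _ => ⟨⟨a.2.1, (key a).1⟩, ⟨a.1.1, ?_⟩⟩) ?_ ?_ ?_ ?_
  · simp only [insertIndex, Finset.mem_insert, not_or]
    exact ⟨(key a).2.symm, a.1.2⟩
  · rintro a -
    have h : insertIndex (insertIndex S ⟨a.2.1, (key a).1⟩) ⟨a.1.1, by
          simp only [insertIndex, Finset.mem_insert, not_or]
          exact ⟨(key a).2.symm, a.1.2⟩⟩ = insertIndex (insertIndex S a.1) a.2 :=
      Subtype.ext (Finset.insert_comm _ _ _)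
    simp only [h, smul_smul, ← add_smul]
    have hsign := koszulSign_insert (R := R) S.1 a.1.2 (key a).1 (key a).2.symm
    have e : ((koszulSign S.1 a.1.1 : R) * x a.1.1) *
          (koszulSign (insertIndex S a.1).1 a.2.1 * x a.2.1) +
        (koszulSign S.1 a.2.1 * x a.2.1) *
          (koszulSign (insertIndex S ⟨a.2.1, (key a).1⟩).1 a.1.1 * x a.1.1) = 0 := by
      simp only [insertIndex]
      linear_combination (x a.1.1 * x a.2.1) * hsign
    rw [e, zero_smul]
  · rintro a - - h
    exact (key a).2 (congrArg (fun b => b.1.1) h)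
  · intros; exact Finset.mem_univ _
  · intros; rfl

/-- The Koszul complex `K.(x₁, …, x_r; X)`. -/
abbrev koszulComplex : ChainComplex (ModuleCat.{v} R) ℕ :=
  ChainComplex.of (fun i => ModuleCat.of R (KoszulX r X i))
    (fun i => ModuleCat.ofHom (koszulD x X i))
    (fun i => by rw [← ModuleCat.ofHom_comp, koszulD_comp]; rfl)

theorem koszulComplex_d (i : ℕ) :
    (koszulComplex x X).d (i + 1) i = ModuleCat.ofHom (koszulD x X i) :=
  ChainComplex.of_d (fun i => ModuleCat.of R (KoszulX r X i))
    (fun i => ModuleCat.ofHom (koszulD x X i)) i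

/-- Multiplication of the coefficient of `e_S` by `∏_{s ∈ S} a_s`. -/
def koszulScale (a : Fin r → R) (i : ℕ) : KoszulX r X i →ₗ[R] KoszulX r X i where
  toFun f S := (∏ s ∈ S.1, a s) • f S
  map_add' f g := by
    funext S
    simp
  map_smul' b f := by
    funext S
    exact smul_comm _ _ _

variable {x} in
theorem koszulD_comp_koszulScale {y z a : Fin r → R} (h : ∀ s, z s = a s * y s) (i : ℕ) :
    koszulD y X i ∘ₗ koszulScale X a (i + 1) = koszulScale X a i ∘ₗ koszulD z X i := by
  apply LinearMap.ext
  intro f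
  funext S
  simp only [LinearMap.comp_apply, koszulD, koszulScale, LinearMap.coe_mk, AddHom.coe_mk,
    Finset.smul_sum, smul_smul]
  refine Finset.sum_congr rfl fun s _ => ?_
  congr 1
  simp only [insertIndex]
  rw [Finset.prod_insert s.2, h]
  ring

/-- If `z_s = a_s y_s` for all `s`, the canonical chain map `K.(z; X) ⟶ K.(y; X)`, which is the
identity in degree `0` and is induced by `e_s ↦ a_s e_s`. -/
def koszulMap {y z a : Fin r → R} (h : ∀ s, z s = a s * y s) :
    koszulComplex z X ⟶ koszulComplex y X :=
  ChainComplex.ofHom (fun i => ModuleCat.ofHom (koszulScale X a i))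
    (fun i => by
      rw [koszulComplex_d, koszulComplex_d]
      exact congrArg ModuleCat.ofHom (koszulD_comp_koszulScale X h i))

/-- The inverse system `n ↦ Hᵢ(K.(x₁ⁿ, …, x_rⁿ; X))`, `n ≥ 1`
(the object at `n : ℕ` belongs to the exponent `n + 1`). -/
def koszulHomologySystem (i : ℕ) : ℕᵒᵖ ⥤ ModuleCat.{v} R :=
  Functor.ofOpSequence (X := fun n => (koszulComplex (fun s => x s ^ (n + 1)) X).homology i)
    (fun n => HomologicalComplex.homologyMap
      (koszulMap X (y := fun s => x s ^ (n + 1)) (z := fun s => x s ^ (n + 1 + 1)) (a := x)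
        (fun s => pow_succ' (x s) (n + 1))) i)

/-- The `i`-th local homology module of `X` with respect to `x = (x₁, …, x_r)`: the inverse limit
of the `i`-th Koszul homology modules `Hᵢ(K.(x₁ⁿ, …, x_rⁿ; X))`. -/
def localHomology (i : ℕ) : ModuleCat.{v} R :=
  limit (koszulHomologySystem x X i)

end Koszul

end LocalHomology

end

/-! Since depth equals dimension, `H^j(M) = 0` for `j < d`, and every system of parameters of `M` is
a regular sequence. This applies to all the powers `y = (x₁ⁿ, …, x_dⁿ)`
(`isRegularSequence_of_isParameterSystem`).

For such `y`, the long exact sequences of `0 → M → M → M / y₁M → 0` and induction on the length give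
everything needed about local cohomology (`toTop_spec`). It vanishes outside degree `d`. On `H^d(M)`
the sequence `y` is coregular: `y₁` is surjective, `y₂` is surjective on the kernel of `y₁`, and so
on. The iterated connecting map `M → H^d(M)` has kernel `(y)M`, and its image is the set of elements
annihilated by `y`. The induction starts from the fact that power torsion modules have no higher
local cohomology, which rests on Artin–Rees.

The Koszul complex of a coregular sequence is exact outside the top degree (`exists_totalD_eq`),
where its homology is the submodule annihilated by `y`, here `M / (y)M`. The Koszul transition map
in top degree is multiplication by `x₁ ⋯ x_d`. Naturality of the connecting maps
(`toTop_naturality`) shows that it corresponds to the projection `M / (xⁿ⁺¹)M → M / (xⁿ)M`. The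
limit is therefore the completion along the submodules `(xⁿ)M`, which are cofinal with the `𝔪ⁿM`
(`nonempty_limit_iso_adicCompletion`). -/

noncomputable section

/-! ### Long exact sequences of left derived functors attached to a sequence of functors. -/

namespace CategoryTheory.ShortComplex

universe v₁ v₂ u₁ u₂

variable {C : Type u₁} [Category.{v₁} C] [Abelian C] [EnoughProjectives C]
  {D : Type u₂} [Category.{v₂} D] [Abelian D]

/-- A short complex of functors is exact on projectives if its value at each projective object is
a short exact sequence. -/
def ExactOnProjectives (T : ShortComplex (C ⥤ D)) : Prop :=
  ∀ (P : C) [Projective P], (T.map ((evaluation C D).obj P)).ShortExact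

section

variable (T : ShortComplex (C ⥤ D)) [T.X₁.Additive] [T.X₂.Additive] [T.X₃.Additive]

/-- The short complex of chain complexes obtained by applying a short complex of additive
functors to a chain complex. -/
def mapChainComplex (K : ChainComplex C ℕ) : ShortComplex (ChainComplex D ℕ) where
  X₁ := (T.X₁.mapHomologicalComplex _).obj K
  X₂ := (T.X₂.mapHomologicalComplex _).obj K
  X₃ := (T.X₃.mapHomologicalComplex _).obj K
  f := (NatTrans.mapHomologicalComplex T.f _).app K
  g := (NatTrans.mapHomologicalComplex T.g _).app K
  zero := by
    ext i
    exact congrArg (fun t => NatTrans.app t (K.X i)) T.zero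

variable {T} in
omit [EnoughProjectives C] in
theorem ExactOnProjectives.mapChainComplex_shortExact (hT : T.ExactOnProjectives)
    (K : ChainComplex C ℕ) [∀ i, Projective (K.X i)] : (T.mapChainComplex K).ShortExact :=
  HomologicalComplex.shortExact_of_degreewise_shortExact _ fun i => hT (K.X i)

/-- A chain map induces a morphism of the associated short complexes. -/
def mapChainComplexMap {K L : ChainComplex C ℕ} (φ : K ⟶ L) :
    T.mapChainComplex K ⟶ T.mapChainComplex L where
  τ₁ := (T.X₁.mapHomologicalComplex _).map φ
  τ₂ := (T.X₂.mapHomologicalComplex _).map φ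
  τ₃ := (T.X₃.mapHomologicalComplex _).map φ
  comm₁₂ := (NatTrans.mapHomologicalComplex T.f (ComplexShape.down ℕ)).naturality φ
  comm₂₃ := (NatTrans.mapHomologicalComplex T.g (ComplexShape.down ℕ)).naturality φ

/-- A morphism of short complexes of functors induces a morphism of the associated short
complexes of chain complexes. -/
def mapChainComplexNat {T T' : ShortComplex (C ⥤ D)} [T.X₁.Additive] [T.X₂.Additive]
    [T.X₃.Additive] [T'.X₁.Additive] [T'.X₂.Additive] [T'.X₃.Additive] (τ : T ⟶ T')
    (K : ChainComplex C ℕ) : T.mapChainComplex K ⟶ T'.mapChainComplex K where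
  τ₁ := (NatTrans.mapHomologicalComplex τ.τ₁ _).app K
  τ₂ := (NatTrans.mapHomologicalComplex τ.τ₂ _).app K
  τ₃ := (NatTrans.mapHomologicalComplex τ.τ₃ _).app K
  comm₁₂ := by
    ext i
    exact congrArg (fun t => NatTrans.app t (K.X i)) τ.comm₁₂
  comm₂₃ := by
    ext i
    exact congrArg (fun t => NatTrans.app t (K.X i)) τ.comm₂₃

instance (X : C) (i : ℕ) : Projective ((projectiveResolution X).complex.X i) :=
  (projectiveResolution X).projective i

variable {T}

theorem downRel (n : ℕ) : (ComplexShape.down ℕ).Rel (n + 1) n := rfl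

variable (T) in
/-- Comparison of a left derived functor with the homology of the first complex. -/
def leftDerivedIso₁ (n : ℕ) (X : C) : (T.X₁.leftDerived n).obj X ≅
    (T.mapChainComplex (projectiveResolution X).complex).X₁.homology n :=
  (projectiveResolution X).isoLeftDerivedObj T.X₁ n

variable (T) in
/-- Comparison of a left derived functor with the homology of the second complex. -/
def leftDerivedIso₂ (n : ℕ) (X : C) : (T.X₂.leftDerived n).obj X ≅
    (T.mapChainComplex (projectiveResolution X).complex).X₂.homology n :=
  (projectiveResolution X).isoLeftDerivedObj T.X₂ n

variable (T) in
/-- Comparison of a left derived functor with the homology of the third complex. -/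
def leftDerivedIso₃ (n : ℕ) (X : C) : (T.X₃.leftDerived n).obj X ≅
    (T.mapChainComplex (projectiveResolution X).complex).X₃.homology n :=
  (projectiveResolution X).isoLeftDerivedObj T.X₃ n

theorem leftDerived_f (n : ℕ) (X : C) : (NatTrans.leftDerived T.f n).app X =
    (T.leftDerivedIso₁ n X).hom ≫ HomologicalComplex.homologyMap
      (T.mapChainComplex (projectiveResolution X).complex).f n ≫ (T.leftDerivedIso₂ n X).inv :=
  ProjectiveResolution.leftDerived_app_eq T.f (projectiveResolution X) n

theorem leftDerived_g (n : ℕ) (X : C) : (NatTrans.leftDerived T.g n).app X =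
    (T.leftDerivedIso₂ n X).hom ≫ HomologicalComplex.homologyMap
      (T.mapChainComplex (projectiveResolution X).complex).g n ≫ (T.leftDerivedIso₃ n X).inv :=
  ProjectiveResolution.leftDerived_app_eq T.g (projectiveResolution X) n

/-- The connecting morphism between left derived functors. -/
def ExactOnProjectives.leftDerivedδ (hT : T.ExactOnProjectives) (n : ℕ) (X : C) :
    (T.X₃.leftDerived (n + 1)).obj X ⟶ (T.X₁.leftDerived n).obj X :=
  (T.leftDerivedIso₃ (n + 1) X).hom ≫
    (hT.mapChainComplex_shortExact (projectiveResolution X).complex).δ (n + 1) n (downRel n) ≫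
      (T.leftDerivedIso₁ n X).inv

theorem ExactOnProjectives.comp_leftDerivedδ (hT : T.ExactOnProjectives) (n : ℕ) (X : C) :
    (NatTrans.leftDerived T.g (n + 1)).app X ≫ hT.leftDerivedδ n X = 0 := by
  rw [leftDerived_g, leftDerivedδ]
  simp

theorem ExactOnProjectives.leftDerivedδ_comp (hT : T.ExactOnProjectives) (n : ℕ) (X : C) :
    hT.leftDerivedδ n X ≫ (NatTrans.leftDerived T.f n).app X = 0 := by
  rw [leftDerived_f, leftDerivedδ]
  simp

theorem leftDerived_comp_eq_zero (n : ℕ) (X : C) :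
    (NatTrans.leftDerived T.f n).app X ≫ (NatTrans.leftDerived T.g n).app X = 0 := by
  rw [leftDerived_f, leftDerived_g]
  simp only [Category.assoc, Iso.inv_hom_id_assoc]
  rw [← HomologicalComplex.homologyMap_comp_assoc, ShortComplex.zero]
  simp

theorem ExactOnProjectives.leftDerived_exact₁ (hT : T.ExactOnProjectives) (n : ℕ) (X : C) :
    (ShortComplex.mk _ _ (hT.leftDerivedδ_comp n X)).Exact := by
  refine ShortComplex.exact_of_iso (ShortComplex.isoMk (T.leftDerivedIso₃ (n + 1) X).symm
    (T.leftDerivedIso₁ n X).symm (T.leftDerivedIso₂ n X).symm ?_ ?_)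
    ((hT.mapChainComplex_shortExact (projectiveResolution X).complex).homology_exact₁
      (n + 1) n (downRel n))
  · simp only [Iso.symm_hom, leftDerivedδ, Iso.inv_hom_id_assoc]
  · simp only [Iso.symm_hom, leftDerived_f, Iso.inv_hom_id_assoc]

theorem ExactOnProjectives.leftDerived_exact₂ (hT : T.ExactOnProjectives) (n : ℕ) (X : C) :
    (ShortComplex.mk _ _ (leftDerived_comp_eq_zero (T := T) n X)).Exact := by
  refine ShortComplex.exact_of_iso (ShortComplex.isoMk (T.leftDerivedIso₁ n X).symm
    (T.leftDerivedIso₂ n X).symm (T.leftDerivedIso₃ n X).symm ?_ ?_)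
    ((hT.mapChainComplex_shortExact (projectiveResolution X).complex).homology_exact₂ n)
  · simp only [Iso.symm_hom, leftDerived_f, Iso.inv_hom_id_assoc]
  · simp only [Iso.symm_hom, leftDerived_g, Iso.inv_hom_id_assoc]

theorem ExactOnProjectives.leftDerived_exact₃ (hT : T.ExactOnProjectives) (n : ℕ) (X : C) :
    (ShortComplex.mk _ _ (hT.comp_leftDerivedδ n X)).Exact := by
  refine ShortComplex.exact_of_iso (ShortComplex.isoMk (T.leftDerivedIso₂ (n + 1) X).symm
    (T.leftDerivedIso₃ (n + 1) X).symm (T.leftDerivedIso₁ n X).symm ?_ ?_)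
    ((hT.mapChainComplex_shortExact (projectiveResolution X).complex).homology_exact₃
      (n + 1) n (downRel n))
  · simp only [Iso.symm_hom, leftDerived_g, Iso.inv_hom_id_assoc]
  · simp only [Iso.symm_hom, leftDerivedδ, Iso.inv_hom_id_assoc]

theorem ExactOnProjectives.leftDerivedδ_naturality (hT : T.ExactOnProjectives) (n : ℕ) {X Y : C}
    (f : X ⟶ Y) :
    (T.X₃.leftDerived (n + 1)).map f ≫ hT.leftDerivedδ n Y =
      hT.leftDerivedδ n X ≫ (T.X₁.leftDerived n).map f := by
  let φ := ProjectiveResolution.lift f (projectiveResolution X) (projectiveResolution Y)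
  have hφ : φ ≫ (projectiveResolution Y).π =
    (projectiveResolution X).π ≫ (ChainComplex.single₀ C).map f :=
    ProjectiveResolution.lift_commutes _ _ _
  have h₃ : (T.X₃.leftDerived (n + 1)).map f = (T.leftDerivedIso₃ (n + 1) X).hom ≫
      HomologicalComplex.homologyMap (T.mapChainComplexMap φ).τ₃ (n + 1) ≫
        (T.leftDerivedIso₃ (n + 1) Y).inv := Functor.leftDerived_map_eq _ _ f φ hφ
  have h₁ : (T.X₁.leftDerived n).map f = (T.leftDerivedIso₁ n X).hom ≫
      HomologicalComplex.homologyMap (T.mapChainComplexMap φ).τ₁ n ≫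
        (T.leftDerivedIso₁ n Y).inv := Functor.leftDerived_map_eq _ _ f φ hφ
  rw [h₃, h₁, leftDerivedδ, leftDerivedδ]
  have := HomologicalComplex.HomologySequence.δ_naturality (T.mapChainComplexMap φ)
    (hT.mapChainComplex_shortExact (projectiveResolution X).complex)
    (hT.mapChainComplex_shortExact (projectiveResolution Y).complex) (n + 1) n (downRel n)
  simp only [Category.assoc, Iso.inv_hom_id_assoc]
  rw [reassoc_of% this]

/-- Naturality in the sequence of functors. For Ext it becomes naturality of the connecting map in
the coefficient sequence, which later controls the transition maps. -/
theorem ExactOnProjectives.leftDerivedδ_natural {T' : ShortComplex (C ⥤ D)} [T'.X₁.Additive]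
    [T'.X₂.Additive] [T'.X₃.Additive] (hT : T.ExactOnProjectives) (hT' : T'.ExactOnProjectives)
    (τ : T ⟶ T') (n : ℕ) (X : C) :
    (NatTrans.leftDerived τ.τ₃ (n + 1)).app X ≫ hT'.leftDerivedδ n X =
      hT.leftDerivedδ n X ≫ (NatTrans.leftDerived τ.τ₁ n).app X := by
  have h₃ : (NatTrans.leftDerived τ.τ₃ (n + 1)).app X = (T.leftDerivedIso₃ (n + 1) X).hom ≫
      HomologicalComplex.homologyMap
        (mapChainComplexNat τ (projectiveResolution X).complex).τ₃ (n + 1) ≫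
        (T'.leftDerivedIso₃ (n + 1) X).inv := ProjectiveResolution.leftDerived_app_eq _ _ _
  have h₁ : (NatTrans.leftDerived τ.τ₁ n).app X = (T.leftDerivedIso₁ n X).hom ≫
      HomologicalComplex.homologyMap
        (mapChainComplexNat τ (projectiveResolution X).complex).τ₁ n ≫
        (T'.leftDerivedIso₁ n X).inv := ProjectiveResolution.leftDerived_app_eq _ _ _
  rw [h₃, h₁, leftDerivedδ, leftDerivedδ]
  have := HomologicalComplex.HomologySequence.δ_naturality
    (mapChainComplexNat τ (projectiveResolution X).complex)
    (hT.mapChainComplex_shortExact (projectiveResolution X).complex)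
    (hT'.mapChainComplex_shortExact (projectiveResolution X).complex) (n + 1) n (downRel n)
  simp only [Category.assoc, Iso.inv_hom_id_assoc]
  rw [reassoc_of% this]

end

end CategoryTheory.ShortComplex

/-- Conjugation by an isomorphism does not affect a natural endomorphism of the identity. This
carries multiplication by a scalar from the homology of a resolution to the derived functor. -/
theorem CategoryTheory.NatTrans.iso_conj_app {D : Type*} [Category* D] (e : 𝟭 D ⟶ 𝟭 D) {A B : D}
    (i : A ≅ B) : i.hom ≫ e.app B ≫ i.inv = e.app A := by
  have := e.naturality i.hom
  dsimp at this
  rw [reassoc_of% this, Iso.hom_inv_id, Category.comp_id]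

namespace HomologicalComplex

/-- A chain endomorphism that is degreewise given by a natural endomorphism of the identity functor
induces this natural endomorphism on homology. -/
theorem homologyMap_eq_app {ι D : Type*} [Category* D] [Abelian D] {c : ComplexShape ι}
    (K : HomologicalComplex D c) (φ : K ⟶ K) (e : 𝟭 D ⟶ 𝟭 D) (h : ∀ i, φ.f i = e.app (K.X i))
    (i : ι) : homologyMap φ i = e.app (K.homology i) := by
  have h₁ : cyclesMap φ i = e.app (K.cycles i) := by
    rw [← cancel_mono (K.iCycles i), cyclesMap_i, h]
    exact e.naturality (K.iCycles i)
  rw [← cancel_epi (K.homologyπ i), homologyπ_naturality, h₁]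
  exact (e.naturality (K.homologyπ i)).symm

end HomologicalComplex

/-! ### Ext modules: long exact sequence in the coefficients, scalars, degree zero. -/

namespace ModuleCat

open Opposite

variable {R : Type u} [CommRing R]

/-- The contravariant functor `Hom(-, Y)`, with values in the opposite category. -/
abbrev homOp (Y : ModuleCat.{u} R) : ModuleCat.{u} R ⥤ (ModuleCat.{u} R)ᵒᵖ :=
  ((linearYoneda R (ModuleCat.{u} R)).obj Y).rightOp

/-- The natural transformation `Hom(-, Z) ⟶ Hom(-, Y)` in the opposite category. -/
abbrev homOpMap {Y Z : ModuleCat.{u} R} (f : Y ⟶ Z) : homOp Z ⟶ homOp Y :=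
  NatTrans.rightOp ((linearYoneda R (ModuleCat.{u} R)).map f)

/-- The `n`-th Ext module. -/
abbrev extObj (X Y : ModuleCat.{u} R) (n : ℕ) : ModuleCat.{u} R :=
  ((Ext R (ModuleCat.{u} R) n).obj (op X)).obj Y

/-- Functoriality of Ext in the second variable. -/
abbrev extPost (X : ModuleCat.{u} R) {Y Z : ModuleCat.{u} R} (f : Y ⟶ Z) (n : ℕ) :
    extObj X Y n ⟶ extObj X Z n :=
  ((Ext R (ModuleCat.{u} R) n).obj (op X)).map f

/-- Functoriality of Ext in the first variable. -/
abbrev extPre {X Y : ModuleCat.{u} R} (f : X ⟶ Y) (Z : ModuleCat.{u} R) (n : ℕ) :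
    extObj Y Z n ⟶ extObj X Z n :=
  ((Ext R (ModuleCat.{u} R) n).map f.op).app Z

/-- The short complex of functors `Hom(-, S)`, in the opposite category. -/
def homOpShortComplex (S : ShortComplex (ModuleCat.{u} R)) :
    ShortComplex (ModuleCat.{u} R ⥤ (ModuleCat.{u} R)ᵒᵖ) where
  X₁ := homOp S.X₃
  X₂ := homOp S.X₂
  X₃ := homOp S.X₁
  f := homOpMap S.g
  g := homOpMap S.f
  zero := by
    ext P
    apply Quiver.Hom.unop_inj
    ext (f : P ⟶ S.X₁)
    change (f ≫ S.f) ≫ S.g = 0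
    simp

instance (S : ShortComplex (ModuleCat.{u} R)) : (homOpShortComplex S).X₁.Additive :=
  inferInstanceAs (homOp S.X₃).Additive

instance (S : ShortComplex (ModuleCat.{u} R)) : (homOpShortComplex S).X₂.Additive :=
  inferInstanceAs (homOp S.X₂).Additive

instance (S : ShortComplex (ModuleCat.{u} R)) : (homOpShortComplex S).X₃.Additive :=
  inferInstanceAs (homOp S.X₁).Additive

/-- Functoriality of `homOpShortComplex`. -/
def homOpShortComplexMap {S S' : ShortComplex (ModuleCat.{u} R)} (τ : S ⟶ S') :
    homOpShortComplex S' ⟶ homOpShortComplex S where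
  τ₁ := homOpMap τ.τ₃
  τ₂ := homOpMap τ.τ₂
  τ₃ := homOpMap τ.τ₁
  comm₁₂ := by
    ext P
    apply Quiver.Hom.unop_inj
    ext (f : P ⟶ S.X₂)
    change (f ≫ S.g) ≫ τ.τ₃ = (f ≫ τ.τ₂) ≫ S'.g
    simp only [Category.assoc, τ.comm₂₃]
  comm₂₃ := by
    ext P
    apply Quiver.Hom.unop_inj
    ext (f : P ⟶ S.X₁)
    change (f ≫ S.f) ≫ τ.τ₂ = (f ≫ τ.τ₁) ≫ S'.f
    simp only [Category.assoc, τ.comm₁₂]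

/-- Ext is a left derived functor of `Hom(-, Y)` into the opposite category, so the coefficient
sequence appears reversed. Right exactness of the original sequence is lifting from the projective
`P` along `S.g`. -/
theorem homOpShortComplex_exactOnProjectives {S : ShortComplex (ModuleCat.{u} R)}
    (hS : S.ShortExact) : (homOpShortComplex S).ExactOnProjectives := by
  intro P _
  have := hS.mono_f
  have := hS.epi_g
  let U : ShortComplex (ModuleCat.{u} R) :=
    ((homOpShortComplex S).map ((evaluation _ _).obj P)).unop
  have hU : U.ShortExact := by
    refine ShortComplex.ShortExact.mk' ?_ ?_ ?_
    · rw [ShortComplex.moduleCat_exact_iff]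
      intro (f : P ⟶ S.X₂) (hf : f ≫ S.g = 0)
      exact ⟨hS.exact.lift f hf, hS.exact.lift_f f hf⟩
    · rw [ModuleCat.mono_iff_injective]
      intro (f : P ⟶ S.X₁) (g : P ⟶ S.X₁) (h : f ≫ S.f = g ≫ S.f)
      exact (cancel_mono S.f).1 h
    · rw [ModuleCat.epi_iff_surjective]
      intro (f : P ⟶ S.X₃)
      exact ⟨Projective.factorThru f S.g, Projective.factorThru_comp f S.g⟩
  exact hU.op

section LongExact

variable {S : ShortComplex (ModuleCat.{u} R)} (hS : S.ShortExact)

/-- The connecting morphism of Ext in the second variable. -/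
def extδ (X : ModuleCat.{u} R) (n : ℕ) : extObj X S.X₃ n ⟶ extObj X S.X₁ (n + 1) :=
  ((homOpShortComplex_exactOnProjectives hS).leftDerivedδ n X).unop

/-- Passage to the opposite category exchanges the two outer terms, hence `leftDerived_exact₃` here
and `leftDerived_exact₁` in `extδ_exact₃`. -/
theorem extδ_exact₁ (X : ModuleCat.{u} R) (n : ℕ) :
    Function.Exact (extδ hS X n) (extPost X S.f (n + 1)) :=
  (ShortComplex.ShortExact.moduleCat_exact_iff_function_exact _).1
    ((homOpShortComplex_exactOnProjectives hS).leftDerived_exact₃ n X).unop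

include hS in
theorem ext_exact₂ (X : ModuleCat.{u} R) (n : ℕ) :
    Function.Exact (extPost X S.f n) (extPost X S.g n) :=
  (ShortComplex.ShortExact.moduleCat_exact_iff_function_exact _).1
    ((homOpShortComplex_exactOnProjectives hS).leftDerived_exact₂ n X).unop

theorem extδ_exact₃ (X : ModuleCat.{u} R) (n : ℕ) :
    Function.Exact (extPost X S.g n) (extδ hS X n) :=
  (ShortComplex.ShortExact.moduleCat_exact_iff_function_exact _).1
    ((homOpShortComplex_exactOnProjectives hS).leftDerived_exact₁ n X).unop

theorem extδ_extPre {X Y : ModuleCat.{u} R} (f : X ⟶ Y) (n : ℕ) :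
    extPre f S.X₃ n ≫ extδ hS X n = extδ hS Y n ≫ extPre f S.X₁ (n + 1) :=
  Quiver.Hom.op_inj
    ((homOpShortComplex_exactOnProjectives hS).leftDerivedδ_naturality n f).symm

theorem extδ_extPost {S' : ShortComplex (ModuleCat.{u} R)} (hS' : S'.ShortExact) (τ : S ⟶ S')
    (X : ModuleCat.{u} R) (n : ℕ) :
    extPost X τ.τ₃ n ≫ extδ hS' X n = extδ hS X n ≫ extPost X τ.τ₁ (n + 1) :=
  Quiver.Hom.op_inj ((homOpShortComplex_exactOnProjectives hS').leftDerivedδ_natural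
    (homOpShortComplex_exactOnProjectives hS) (homOpShortComplexMap τ) n X).symm

end LongExact

/-- Multiplication by `a` as an endomorphism of the identity functor. -/
def homOpSMul (a : R) : 𝟭 (ModuleCat.{u} R)ᵒᵖ ⟶ 𝟭 (ModuleCat.{u} R)ᵒᵖ where
  app M := (a • 𝟙 M.unop).op
  naturality M N f := by
    apply Quiver.Hom.unop_inj
    change (a • 𝟙 N.unop) ≫ f.unop = f.unop ≫ (a • 𝟙 M.unop)
    simp

theorem extPost_smul_id (X Y : ModuleCat.{u} R) (a : R) (n : ℕ) :
    extPost X (a • 𝟙 Y) n = a • 𝟙 (extObj X Y n) := by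
  apply Quiver.Hom.op_inj
  change (NatTrans.leftDerived (homOpMap (a • 𝟙 Y)) n).app X =
    (homOpSMul a).app (((homOp Y).leftDerived n).obj X)
  rw [ProjectiveResolution.leftDerived_app_eq _ (CategoryTheory.projectiveResolution X)]
  have := HomologicalComplex.homologyMap_eq_app _ ((NatTrans.mapHomologicalComplex
    (homOpMap (a • 𝟙 Y)) (ComplexShape.down ℕ)).app
      (CategoryTheory.projectiveResolution X).complex)
    (homOpSMul a) (fun i => by
      apply Quiver.Hom.unop_inj
      ext (f : (CategoryTheory.projectiveResolution X).complex.X i ⟶ Y)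
      change f ≫ (a • 𝟙 Y) = a • f
      simp) n
  change _ ≫ HomologicalComplex.homologyMap _ n ≫ _ = _
  rw [this]
  exact NatTrans.iso_conj_app (homOpSMul a)
    ((CategoryTheory.projectiveResolution X).isoLeftDerivedObj (homOp Y) n)

theorem extPre_smul_id (X Y : ModuleCat.{u} R) (a : R) (n : ℕ) :
    extPre (a • 𝟙 X) Y n = a • 𝟙 (extObj X Y n) := by
  apply Quiver.Hom.op_inj
  change ((homOp Y).leftDerived n).map (a • 𝟙 X) =
    (homOpSMul a).app (((homOp Y).leftDerived n).obj X)
  rw [Functor.leftDerived_map_eq _ _ _ (P := CategoryTheory.projectiveResolution X)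
    (Q := CategoryTheory.projectiveResolution X)
    (a • 𝟙 (CategoryTheory.projectiveResolution X).complex) (by
      ext
      simp
      rfl)]
  have := HomologicalComplex.homologyMap_eq_app _
    (((homOp Y).mapHomologicalComplex (ComplexShape.down ℕ)).map
      (a • 𝟙 (CategoryTheory.projectiveResolution X).complex))
    (homOpSMul a) (fun i => by
      apply Quiver.Hom.unop_inj
      ext (f : (CategoryTheory.projectiveResolution X).complex.X i ⟶ Y)
      change (a • 𝟙 ((CategoryTheory.projectiveResolution X).complex.X i)) ≫ f = a • f
      simp) n
  change _ ≫ HomologicalComplex.homologyMap _ n ≫ _ = _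
  rw [this]
  exact NatTrans.iso_conj_app (homOpSMul a)
    ((CategoryTheory.projectiveResolution X).isoLeftDerivedObj (homOp Y) n)

/-- An element that annihilates `X` annihilates Ext out of `X`. -/
theorem smul_ext_eq_zero {X : ModuleCat.{u} R} {a : R} (ha : ∀ x : X, a • x = 0)
    (Y : ModuleCat.{u} R) (n : ℕ) (e : extObj X Y n) : a • e = 0 := by
  have h : a • 𝟙 X = (0 : X ⟶ X) := by
    ext x
    exact ha x
  have h' := extPre_smul_id X Y a n
  rw [h] at h'
  have h₀ : extPre (0 : X ⟶ X) Y n = 0 := by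
    have := extPre_smul_id X Y 0 n
    rwa [zero_smul, zero_smul] at this
  have := congrArg (fun f => f.hom e) (h'.symm.trans h₀)
  exact this

/-- Higher Ext into an injective module vanishes. -/
theorem isZero_ext_succ_of_injective (X E : ModuleCat.{u} R) [Injective E] (n : ℕ) :
    IsZero (extObj X E (n + 1)) := by
  have h : IsZero (((homOp E).leftDerived (n + 1)).obj X) := by
    refine IsZero.of_iso ?_
      ((CategoryTheory.projectiveResolution X).isoLeftDerivedObj (homOp E) (n + 1))
    change IsZero (HomologicalComplex.homology _ _)
    rw [← HomologicalComplex.exactAt_iff_isZero_homology]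
    rw [HomologicalComplex.exactAt_iff' _ (n + 2) (n + 1) n (by simp) (by simp)]
    let U : ShortComplex (ModuleCat.{u} R) := ((((homOp E).mapHomologicalComplex
      (ComplexShape.down ℕ)).obj (CategoryTheory.projectiveResolution X).complex).sc'
        (n + 2) (n + 1) n).unop
    have hU : U.Exact := by
      rw [ShortComplex.moduleCat_exact_iff]
      intro (f : (CategoryTheory.projectiveResolution X).complex.X (n + 1) ⟶ E)
        (hf : (CategoryTheory.projectiveResolution X).complex.d (n + 2) (n + 1) ≫ f = 0)
      exact ⟨((CategoryTheory.projectiveResolution X).exact_succ n).descToInjective f hf,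
        ((CategoryTheory.projectiveResolution X).exact_succ n).comp_descToInjective f hf⟩
    exact hU.op
  exact h.unop

/-- Left exactness of Hom, read in the opposite category; it identifies the zeroth left derived
functor with Hom itself. -/
instance (Y : ModuleCat.{u} R) : PreservesFiniteColimits (homOp Y) := by
  have : PreservesLimitsOfSize.{0, 0} ((linearYoneda R (ModuleCat.{u} R)).obj Y) := by
    have : PreservesLimitsOfSize.{0, 0} ((linearYoneda R (ModuleCat.{u} R)).obj Y ⋙
      forget (ModuleCat.{u} R)) := inferInstanceAs (PreservesLimitsOfSize.{0, 0} (yoneda.obj Y))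
    exact preservesLimits_of_reflects_of_preserves _ (forget (ModuleCat.{u} R))
  exact preservesFiniteColimits_rightOp _

/-- The isomorphism `Hom(X, Y) ≅ Ext⁰(X, Y)`. -/
def extZeroIso (X Y : ModuleCat.{u} R) : ModuleCat.of R (X ⟶ Y) ≅ extObj X Y 0 :=
  ((homOp Y).leftDerivedZeroIsoSelf.app X).unop

theorem extZeroIso_extPre {X X' : ModuleCat.{u} R} (f : X ⟶ X') (Y : ModuleCat.{u} R)
    (g : X' ⟶ Y) :
    extPre f Y 0 ((extZeroIso X' Y).hom g) = (extZeroIso X Y).hom (f ≫ g : X ⟶ Y) := by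
  have := (homOp Y).leftDerivedZeroIsoSelf.hom.naturality f
  exact congrArg (fun t => t.unop.hom g) this

/-- This is naturality in the functor rather than in its argument. It is checked on a resolution, at
the level of opcycles, where `pOpcycles` can be cancelled. -/
theorem extZeroIso_extPost (X : ModuleCat.{u} R) {Y Y' : ModuleCat.{u} R} (f : Y ⟶ Y')
    (g : X ⟶ Y) :
    extPost X f 0 ((extZeroIso X Y).hom g) = (extZeroIso X Y').hom (g ≫ f : X ⟶ Y') := by
  have : (NatTrans.leftDerived (homOpMap f) 0).app X ≫ (homOp Y).fromLeftDerivedZero.app X =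
      (homOp Y').fromLeftDerivedZero.app X ≫ (homOpMap f).app X := by
    let P := CategoryTheory.projectiveResolution X
    let α := (NatTrans.mapHomologicalComplex (homOpMap f) (ComplexShape.down ℕ)).app P.complex
    rw [ProjectiveResolution.leftDerived_app_eq _ P, P.fromLeftDerivedZero_eq,
      P.fromLeftDerivedZero_eq]
    simp only [Category.assoc, Iso.inv_hom_id_assoc]
    congr 1
    have h₁ : HomologicalComplex.opcyclesMap α 0 ≫ P.fromLeftDerivedZero' (homOp Y) =
        P.fromLeftDerivedZero' (homOp Y') ≫ (homOpMap f).app X := by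
      rw [← cancel_epi (HomologicalComplex.pOpcycles _ _), HomologicalComplex.p_opcyclesMap_assoc,
        ProjectiveResolution.pOpcycles_comp_fromLeftDerivedZero',
        ProjectiveResolution.pOpcycles_comp_fromLeftDerivedZero'_assoc]
      exact ((homOpMap f).naturality _).symm
    have h₂ := HomologicalComplex.homologyι_naturality α 0
    change HomologicalComplex.homologyMap α 0 ≫ HomologicalComplex.homologyι _ 0 ≫ _ =
      (HomologicalComplex.homologyι _ 0 ≫ _) ≫ _
    rw [Category.assoc, ← h₁, reassoc_of% h₂]
  exact congrArg (fun t => t.unop.hom g) this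

end ModuleCat

/-! ### Local cohomology as a filtered colimit of Ext: long exact sequence and degree zero. -/

namespace localCohomology

open Opposite ModuleCat

variable {R : Type u} [CommRing R] (J : Ideal R)

/-- The index category of the colimit lives in `Type`, the modules in `Type u`; describing elements
of the colimit needs preservation at the smaller size. -/
instance : PreservesFilteredColimitsOfSize.{0, 0} (forget (ModuleCat.{u} R)) :=
  preservesFilteredColimitsOfSize_shrink.{0, u, 0, u} _

/-- The diagram of Ext modules whose colimit is the local cohomology of `M`. -/
abbrev extDiagram (M : ModuleCat.{u} R) (n : ℕ) : ℕᵒᵖᵒᵖ ⥤ ModuleCat.{u} R :=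
  diagram (idealPowersDiagram J) n ⋙ (evaluation _ _).obj M

/-- The colimit cocone with point the local cohomology of `M`. -/
def cocone (M : ModuleCat.{u} R) (n : ℕ) : Cocone (extDiagram J M n) :=
  ((evaluation _ _).obj M).mapCocone (colimit.cocone (diagram (idealPowersDiagram J) n))

/-- The cocone defining the local cohomology of `M` is a colimit cocone. -/
def isColimitCocone (M : ModuleCat.{u} R) (n : ℕ) : IsColimit (cocone J M n) :=
  isColimitOfPreserves ((evaluation _ _).obj M)
    (colimit.isColimit (diagram (idealPowersDiagram J) n))

/-- The quotient of `R` by a power of `J`. -/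
abbrev quotPow (k : ℕ) : ModuleCat.{u} R := ModuleCat.of R (R ⧸ J ^ k)

/-- The projection between quotients by powers of `J`. -/
abbrev quotPowMap {k l : ℕ} (h : k ≤ l) : quotPow J l ⟶ quotPow J k :=
  (ringModIdeals (idealPowersDiagram J)).map (homOfLE h).op

/-- The canonical map from Ext to local cohomology. -/
def fromExt (k : ℕ) (M : ModuleCat.{u} R) (n : ℕ) :
    extObj (quotPow J k) M n ⟶ (localCohomology J n).obj M :=
  (cocone J M n).ι.app (op (op k))

variable {J}

theorem fromExt_map (k : ℕ) {M N : ModuleCat.{u} R} (f : M ⟶ N) (n : ℕ) :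
    fromExt J k M n ≫ (localCohomology J n).map f =
      extPost (quotPow J k) f n ≫ fromExt J k N n :=
  ((colimit.ι (diagram (idealPowersDiagram J) n) (op (op k))).naturality f).symm

theorem fromExt_map_apply (k : ℕ) {M N : ModuleCat.{u} R} (f : M ⟶ N) (n : ℕ)
    (e : extObj (quotPow J k) M n) :
    (localCohomology J n).map f (fromExt J k M n e) =
      fromExt J k N n (extPost (quotPow J k) f n e) :=
  congrArg (fun t => t.hom e) (fromExt_map k f n)

theorem extPre_fromExt_apply {k l : ℕ} (h : k ≤ l) (M : ModuleCat.{u} R) (n : ℕ)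
    (e : extObj (quotPow J k) M n) :
    fromExt J l M n (extPre (quotPowMap J h) M n e) = fromExt J k M n e :=
  congrArg (fun t => t.hom e) ((cocone J M n).w (homOfLE h).op.op)

/-- With `fromExt_eq_zero`, this describes the filtered colimit by elements; the later diagram
chases run on representatives in Ext. -/
theorem exists_fromExt_eq {M : ModuleCat.{u} R} {n : ℕ} (h : (localCohomology J n).obj M) :
    ∃ k e, fromExt J k M n e = h := by
  obtain ⟨k, e, he⟩ := Concrete.isColimit_exists_rep _ (isColimitCocone J M n) h
  exact ⟨k.unop.unop, e, he⟩

theorem fromExt_eq_zero {k : ℕ} {M : ModuleCat.{u} R} {n : ℕ} {e : extObj (quotPow J k) M n}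
    (he : fromExt J k M n e = 0) :
    ∃ (l : ℕ) (h : k ≤ l), extPre (quotPowMap J h) M n e = 0 := by
  obtain ⟨l, f, g, hfg⟩ := Concrete.isColimit_exists_of_rep_eq _ (isColimitCocone J M n)
    (i := op (op k)) (j := op (op k)) e 0 (by
      rw [map_zero]
      exact he)
  refine ⟨l.unop.unop, leOfHom f.unop.unop, ?_⟩
  rw [map_zero] at hfg
  exact hfg

theorem map_smul_id (M : ModuleCat.{u} R) (n : ℕ) (a : R) :
    (localCohomology J n).map (a • 𝟙 M) = a • 𝟙 _ := by
  ext h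
  obtain ⟨k, e, rfl⟩ := exists_fromExt_eq h
  refine (fromExt_map_apply k (a • 𝟙 M) n e).trans ?_
  rw [extPost_smul_id]
  exact (fromExt J k M n).hom.map_smul a e

theorem map_smul_hom {M N : ModuleCat.{u} R} (n : ℕ) (a : R) (f : M ⟶ N) :
    (localCohomology J n).map (a • f) = a • (localCohomology J n).map f := by
  have : a • f = (a • 𝟙 M) ≫ f := by simp
  rw [this, Functor.map_comp, map_smul_id]
  simp

variable (J) in
/-- Every element of the module is annihilated by a power of the ideal. -/
def IsPowTorsion (M : Type u) [AddCommGroup M] [Module R M] : Prop :=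
  ∀ m : M, ∃ k : ℕ, ∀ a ∈ J ^ k, a • m = 0

/-- A class coming from Ext out of `R ⧸ J ^ k` is killed by `J ^ k`, because its first argument is.
-/
theorem isPowTorsion (M : ModuleCat.{u} R) (n : ℕ) :
    IsPowTorsion J ((localCohomology J n).obj M) := by
  intro h
  obtain ⟨k, e, rfl⟩ := exists_fromExt_eq h
  refine ⟨k, fun a ha => ?_⟩
  refine ((fromExt J k M n).hom.map_smul a e).symm.trans ?_
  rw [smul_ext_eq_zero (fun x => ?_), map_zero]
  obtain ⟨x, rfl⟩ := Submodule.Quotient.mk_surjective _ x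
  rw [← Submodule.Quotient.mk_smul, Submodule.Quotient.mk_eq_zero, smul_eq_mul]
  exact Ideal.mul_mem_right _ _ ha

theorem isZero_of_injective (E : ModuleCat.{u} R) [Injective E] (n : ℕ) :
    IsZero ((localCohomology J (n + 1)).obj E) := by
  rw [ModuleCat.isZero_iff_subsingleton]
  refine subsingleton_of_forall_eq 0 fun h => ?_
  obtain ⟨k, e, rfl⟩ := exists_fromExt_eq h
  have := ModuleCat.subsingleton_of_isZero (isZero_ext_succ_of_injective (quotPow J k) E n)
  rw [Subsingleton.elim e 0, map_zero]

section LongExact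

variable {S : ShortComplex (ModuleCat.{u} R)} (hS : S.ShortExact)

variable (J) in
/-- The connecting morphism of local cohomology. -/
def δ (n : ℕ) : (localCohomology J n).obj S.X₃ ⟶ (localCohomology J (n + 1)).obj S.X₁ :=
  (isColimitCocone J S.X₃ n).map (cocone J S.X₁ (n + 1))
    { app := fun k => extδ hS (quotPow J k.unop.unop) n
      naturality := fun _ _ f =>
        extδ_extPre hS ((ringModIdeals (idealPowersDiagram J)).map f.unop) n }

theorem fromExt_δ (k n : ℕ) (e : extObj (quotPow J k) S.X₃ n) :
    δ J hS n (fromExt J k S.X₃ n e) =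
      fromExt J k S.X₁ (n + 1) (extδ hS (quotPow J k) n e) :=
  congrArg (fun t => t.hom e) ((isColimitCocone J S.X₃ n).ι_map (cocone J S.X₁ (n + 1))
    { app := fun k => extδ hS (quotPow J k.unop.unop) n
      naturality := fun _ _ f =>
        extδ_extPre hS ((ringModIdeals (idealPowersDiagram J)).map f.unop) n } (op (op k)))

theorem extPre_extPost_apply {X Y : ModuleCat.{u} R} (f : X ⟶ Y) {M N : ModuleCat.{u} R}
    (g : M ⟶ N) (n : ℕ) (e : extObj Y M n) :
    extPre f N n (extPost Y g n e) = extPost X g n (extPre f M n e) :=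
  congrArg (fun t => t.hom e) (((Ext R (ModuleCat.{u} R) n).map f.op).naturality g)

theorem extPre_extδ_apply {X Y : ModuleCat.{u} R} (f : X ⟶ Y) (n : ℕ) (e : extObj Y S.X₃ n) :
    extPre f S.X₁ (n + 1) (extδ hS Y n e) = extδ hS X n (extPre f S.X₃ n e) :=
  congrArg (fun t => t.hom e) (extδ_extPre hS f n).symm

/-- Filtered colimits are exact: a class that dies in the colimit already dies at some stage `l`,
and the Ext sequence at that stage provides the preimage. -/
theorem exact_δ_map_f (n : ℕ) :
    Function.Exact (δ J hS n) ((localCohomology J (n + 1)).map S.f) := by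
  intro h
  constructor
  · intro hh
    obtain ⟨k, e, rfl⟩ := exists_fromExt_eq h
    rw [fromExt_map_apply] at hh
    obtain ⟨l, hl, he⟩ := fromExt_eq_zero hh
    rw [extPre_extPost_apply] at he
    obtain ⟨e', he'⟩ := (extδ_exact₁ hS _ n _).1 he
    exact ⟨fromExt J l S.X₃ n e', by rw [fromExt_δ, he', extPre_fromExt_apply]⟩
  · rintro ⟨h, rfl⟩
    obtain ⟨k, e, rfl⟩ := exists_fromExt_eq h
    rw [fromExt_δ, fromExt_map_apply, (extδ_exact₁ hS _ n _).2 ⟨e, rfl⟩, map_zero]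

include hS in
theorem exact_map_f_map_g (n : ℕ) :
    Function.Exact ((localCohomology J n).map S.f) ((localCohomology J n).map S.g) := by
  intro h
  constructor
  · intro hh
    obtain ⟨k, e, rfl⟩ := exists_fromExt_eq h
    rw [fromExt_map_apply] at hh
    obtain ⟨l, hl, he⟩ := fromExt_eq_zero hh
    rw [extPre_extPost_apply] at he
    obtain ⟨e', he'⟩ := (ext_exact₂ hS _ n _).1 he
    exact ⟨fromExt J l S.X₁ n e', by rw [fromExt_map_apply, he', extPre_fromExt_apply]⟩
  · rintro ⟨h, rfl⟩
    obtain ⟨k, e, rfl⟩ := exists_fromExt_eq h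
    rw [fromExt_map_apply, fromExt_map_apply, (ext_exact₂ hS _ n _).2 ⟨e, rfl⟩, map_zero]

theorem exact_map_g_δ (n : ℕ) :
    Function.Exact ((localCohomology J n).map S.g) (δ J hS n) := by
  intro h
  constructor
  · intro hh
    obtain ⟨k, e, rfl⟩ := exists_fromExt_eq h
    rw [fromExt_δ] at hh
    obtain ⟨l, hl, he⟩ := fromExt_eq_zero hh
    rw [extPre_extδ_apply] at he
    obtain ⟨e', he'⟩ := (extδ_exact₃ hS _ n _).1 he
    exact ⟨fromExt J l S.X₂ n e', by rw [fromExt_map_apply, he', extPre_fromExt_apply]⟩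
  · rintro ⟨h, rfl⟩
    obtain ⟨k, e, rfl⟩ := exists_fromExt_eq h
    rw [fromExt_map_apply, fromExt_δ, (extδ_exact₃ hS _ n _).2 ⟨e, rfl⟩, map_zero]

theorem δ_naturality {S' : ShortComplex (ModuleCat.{u} R)} (hS' : S'.ShortExact) (τ : S ⟶ S')
    (n : ℕ) (h : (localCohomology J n).obj S.X₃) :
    δ J hS' n ((localCohomology J n).map τ.τ₃ h) =
      (localCohomology J (n + 1)).map τ.τ₁ (δ J hS n h) := by
  obtain ⟨k, e, rfl⟩ := exists_fromExt_eq h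
  rw [fromExt_map_apply, fromExt_δ, fromExt_δ, fromExt_map_apply]
  exact congrArg (fun t => fromExt J k S'.X₁ (n + 1) (t.hom e)) (extδ_extPost hS hS' τ _ n)

end LongExact

section Zero

/-- Evaluation at the class of `1`. -/
def evalOne (k : ℕ) (M : ModuleCat.{u} R) :
    ModuleCat.of R (quotPow J k ⟶ M) ⟶ M :=
  ModuleCat.ofHom (Y := M)
    { toFun := fun f : quotPow J k ⟶ M => f.hom (Submodule.Quotient.mk 1)
      map_add' := fun _ _ => rfl
      map_smul' := fun _ _ => rfl }

theorem extPre_extZeroIso_inv_evalOne {k l : ℕ} (h : k ≤ l) (M : ModuleCat.{u} R) :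
    extPre (quotPowMap J h) M 0 ≫ (extZeroIso (quotPow J l) M).inv ≫ evalOne l M =
      (extZeroIso (quotPow J k) M).inv ≫ evalOne k M := by
  rw [← cancel_epi (extZeroIso (quotPow J k) M).hom, Iso.hom_inv_id_assoc]
  ext (g : quotPow J k ⟶ M)
  have := extZeroIso_extPre (quotPowMap J h) M g
  change evalOne l M ((extZeroIso (quotPow J l) M).inv (extPre (quotPowMap J h) M 0
    ((extZeroIso (quotPow J k) M).hom g))) = evalOne k M g
  rw [this, Iso.hom_inv_id_apply]
  rfl

variable (J) in
/-- The cocone of evaluations at the class of `1`. -/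
def evalOneCocone (M : ModuleCat.{u} R) : Cocone (extDiagram J M 0) where
  pt := M
  ι :=
    { app := fun k => (extZeroIso (quotPow J k.unop.unop) M).inv ≫ evalOne k.unop.unop M
      naturality := fun _ _ f =>
        (extPre_extZeroIso_inv_evalOne (leOfHom f.unop.unop) M).trans (Category.comp_id _).symm }

variable (J) in
/-- The canonical map from local cohomology in degree zero to the module. -/
def zeroToSelf (M : ModuleCat.{u} R) : (localCohomology J 0).obj M ⟶ M :=
  (isColimitCocone J M 0).desc (evalOneCocone J M)

theorem fromExt_zeroToSelf {k : ℕ} {M : ModuleCat.{u} R} (g : quotPow J k ⟶ M) :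
    zeroToSelf J M (fromExt J k M 0 ((extZeroIso (quotPow J k) M).hom g)) =
      g.hom (Submodule.Quotient.mk 1) := by
  have := (isColimitCocone J M 0).fac (evalOneCocone J M) (op (op k))
  refine (congrArg (fun t => t.hom ((extZeroIso (quotPow J k) M).hom g)) this).trans ?_
  change evalOne k M ((extZeroIso (quotPow J k) M).inv ((extZeroIso (quotPow J k) M).hom g)) = _
  rw [Iso.hom_inv_id_apply]
  rfl

theorem exists_fromExt_extZeroIso_eq {M : ModuleCat.{u} R} (h : (localCohomology J 0).obj M) :
    ∃ (k : ℕ) (g : quotPow J k ⟶ M),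
      fromExt J k M 0 ((extZeroIso (quotPow J k) M).hom g) = h := by
  obtain ⟨k, e, rfl⟩ := exists_fromExt_eq h
  exact ⟨k, (extZeroIso (quotPow J k) M).inv e, by simp⟩

theorem zeroToSelf_naturality {M N : ModuleCat.{u} R} (f : M ⟶ N)
    (h : (localCohomology J 0).obj M) :
    zeroToSelf J N ((localCohomology J 0).map f h) = f (zeroToSelf J M h) := by
  obtain ⟨k, g, rfl⟩ := exists_fromExt_extZeroIso_eq h
  rw [fromExt_map_apply, extZeroIso_extPost, fromExt_zeroToSelf, fromExt_zeroToSelf]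
  rfl

theorem zeroToSelf_injective (M : ModuleCat.{u} R) : Function.Injective (zeroToSelf J M) := by
  refine (injective_iff_map_eq_zero _).2 fun h hh => ?_
  obtain ⟨k, g, rfl⟩ := exists_fromExt_extZeroIso_eq h
  rw [fromExt_zeroToSelf] at hh
  have : g = 0 := by
    refine ModuleCat.hom_ext (LinearMap.ext fun x => ?_)
    obtain ⟨x, rfl⟩ := Submodule.Quotient.mk_surjective _ x
    have : (Submodule.Quotient.mk x : R ⧸ J ^ k) = x • Submodule.Quotient.mk 1 := by
      rw [← Submodule.Quotient.mk_smul, smul_eq_mul, mul_one]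
    rw [this, LinearMap.map_smul, hh, smul_zero]
    rfl
  subst this
  rw [show (extZeroIso (quotPow J k) M).hom (0 : quotPow J k ⟶ M) = 0 from
    map_zero (extZeroIso (quotPow J k) M).hom.hom, map_zero]

theorem mem_range_zeroToSelf {M : ModuleCat.{u} R} {m : M} {k : ℕ}
    (hm : ∀ a ∈ J ^ k, a • m = 0) : ∃ h, zeroToSelf J M h = m := by
  refine ⟨fromExt J k M 0 ((extZeroIso (quotPow J k) M).hom
    (ModuleCat.ofHom (Submodule.liftQ _ (LinearMap.toSpanSingleton R M m) fun a ha => hm a ha))),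
    ?_⟩
  rw [fromExt_zeroToSelf]
  exact one_smul R m

theorem zeroToSelf_bijective {M : ModuleCat.{u} R} (hM : IsPowTorsion J M) :
    Function.Bijective (zeroToSelf J M) :=
  ⟨zeroToSelf_injective M, fun m => mem_range_zeroToSelf (hM m).choose_spec⟩

end Zero

end localCohomology

/-! ### Vanishing for power torsion modules and below the length of a regular sequence. -/

namespace localCohomology

open ModuleCat Pointwise

variable {R : Type u} [CommRing R] {J : Ideal R}

variable (J) in
/-- The submodule of elements annihilated by a power of `J`. -/
def powTorsion (M : Type u) [AddCommGroup M] [Module R M] : Submodule R M where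
  carrier := {m | ∃ k : ℕ, ∀ a ∈ J ^ k, a • m = 0}
  add_mem' := by
    rintro m n ⟨k, hk⟩ ⟨l, hl⟩
    refine ⟨k + l, fun a ha => ?_⟩
    rw [smul_add, hk a (Ideal.pow_le_pow_right (Nat.le_add_right k l) ha),
      hl a (Ideal.pow_le_pow_right (Nat.le_add_left l k) ha), add_zero]
  zero_mem' := ⟨0, fun a _ => smul_zero a⟩
  smul_mem' := by
    rintro b m ⟨k, hk⟩
    exact ⟨k, fun a ha => by rw [smul_comm, hk a ha, smul_zero]⟩

theorem isPowTorsion_powTorsion (M : Type u) [AddCommGroup M] [Module R M] :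
    IsPowTorsion J (powTorsion J M) := by
  rintro ⟨m, k, hk⟩
  exact ⟨k, fun a ha => Subtype.ext (hk a ha)⟩

theorem IsPowTorsion.of_surjective {M N : Type u} [AddCommGroup M] [Module R M] [AddCommGroup N]
    [Module R N] (hM : IsPowTorsion J M) (f : M →ₗ[R] N) (hf : Function.Surjective f) :
    IsPowTorsion J N := by
  intro n
  obtain ⟨m, rfl⟩ := hf n
  obtain ⟨k, hk⟩ := hM m
  exact ⟨k, fun a ha => by rw [← map_smul, hk a ha, map_zero]⟩

/-- The image of a finitely generated module in a power torsion module is annihilated by a power of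
the ideal. -/
theorem IsPowTorsion.exists_pow_smul_range_eq_zero {M N : Type u} [AddCommGroup M] [Module R M]
    [AddCommGroup N] [Module R N] [Module.Finite R N] (hM : IsPowTorsion J M) (f : N →ₗ[R] M) :
    ∃ k : ℕ, ∀ a ∈ J ^ k, ∀ n, f (a • n) = 0 := by
  obtain ⟨s, hs⟩ := Module.Finite.fg_top (R := R) (M := N)
  choose k hk using hM
  refine ⟨s.sup fun n => k (f n), fun a ha n => ?_⟩
  have : n ∈ Submodule.span R (s : Set N) := by rw [hs]; trivial
  induction this using Submodule.span_induction with
  | mem n hn =>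
    rw [map_smul]
    exact hk _ a (Ideal.pow_le_pow_right (Finset.le_sup (f := fun n => k (f n)) hn) ha)
  | zero => simp
  | add m n _ _ hm hn => rw [smul_add, map_add, hm, hn, add_zero]
  | smul b n _ hn => rw [smul_comm, map_smul, hn, smul_zero]

/-- Over a Noetherian ring, the power torsion of an injective module is injective. -/
theorem injective_powTorsion [IsNoetherianRing R] (E : Type u) [AddCommGroup E] [Module R E]
    (hE : Module.Injective R E) : Module.Injective R (powTorsion J E) := by
  apply Module.Baer.injective
  intro I f
  obtain ⟨k, hk⟩ := (isPowTorsion_powTorsion (J := J) E).exists_pow_smul_range_eq_zero f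
  -- Artin–Rees: `J ^ (c + k) ∩ I ⊆ J ^ k I`, which `f` kills. So `f` factors through a submodule of
  -- `R ⧸ J ^ (c + k)`; an extension to all of that quotient, which exists as `E` is injective, has
  -- power torsion values.
  obtain ⟨c, hc⟩ := Ideal.exists_pow_inf_eq_pow_smul J (M := R) I
  have key : Submodule.comap (Submodule.subtype I) (J ^ (c + k)) ≤ LinearMap.ker f := by
    intro y hy
    have h : (y : R) ∈ J ^ (c + k) • (⊤ : Submodule R R) ⊓ I := ⟨by simpa using hy, y.2⟩
    rw [hc (c + k) (Nat.le_add_right c k), Nat.add_sub_cancel_left] at h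
    have h' : (y : R) ∈ J ^ k • I := Submodule.smul_mono le_rfl inf_le_right h
    have h₀ : (J ^ k • (⊤ : Submodule R I)).map (Submodule.subtype I) = J ^ k • I := by
      rw [Submodule.map_smul'', Submodule.map_top, Submodule.range_subtype]
    rw [← h₀] at h'
    obtain ⟨z, hz, hzy⟩ := h'
    obtain rfl : z = y := Subtype.ext hzy
    have : J ^ k • (⊤ : Submodule R I) ≤ LinearMap.ker f :=
      Submodule.smul_le.2 fun b hb x _ => hk b hb x
    exact this hz
  obtain ⟨h, hh⟩ := Module.Injective.out
    (Submodule.mapQ (Submodule.comap (Submodule.subtype I) (J ^ (c + k))) (J ^ (c + k))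
      (Submodule.subtype I) le_rfl)
    (LinearMap.ker_eq_bot.1 (by rw [Submodule.ker_mapQ, Submodule.mkQ_map_self]))
    (Submodule.liftQ _ ((powTorsion J E).subtype ∘ₗ f) (fun y hy => by
      rw [LinearMap.mem_ker, LinearMap.comp_apply, key hy, map_zero]))
  refine ⟨LinearMap.codRestrict (powTorsion J E) (h ∘ₗ Submodule.mkQ _) fun r =>
    ⟨c + k, fun a ha => ?_⟩, fun x hx => Subtype.ext (hh (Submodule.Quotient.mk ⟨x, hx⟩))⟩
  rw [← LinearMap.map_smul, LinearMap.comp_apply, Submodule.mkQ_apply,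
    (Submodule.Quotient.mk_eq_zero _).2 (show a • r ∈ J ^ (c + k) from
      Ideal.mul_mem_right _ _ ha), map_zero]

/-- Power torsion modules over a Noetherian ring have no higher local cohomology. -/
theorem isZero_succ_of_isPowTorsion [IsNoetherianRing R] (n : ℕ) (M : ModuleCat.{u} R)
    (hM : IsPowTorsion J M) : IsZero ((localCohomology J (n + 1)).obj M) := by
  induction n using Nat.strong_induction_on generalizing M with
  | _ n ih =>
  let E := Injective.under M
  have hE : Module.Injective R E := by
    have : Injective (ModuleCat.of R E) := inferInstanceAs (Injective (Injective.under M))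
    exact Module.injective_module_of_injective_object R E
  -- The torsion part of the injective hull still contains `M`, is injective, and has power torsion
  -- cokernel, so dimension shifting stays within power torsion modules.
  let Γ := ModuleCat.of R (powTorsion J E)
  have hΓ : Injective Γ := by
    have := injective_powTorsion (J := J) E hE
    exact Module.injective_object_of_injective_module R (powTorsion J E)
  have hι : Function.Injective (Injective.ι M) := (ModuleCat.mono_iff_injective _).1 inferInstance
  let i : M →ₗ[R] powTorsion J E := LinearMap.codRestrict _ (Injective.ι M).hom fun m => by
    obtain ⟨k, hk⟩ := hM m
    exact ⟨k, fun a ha => by rw [← map_smul, hk a ha, map_zero]⟩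
  let S : ShortComplex (ModuleCat.{u} R) := ModuleCat.shortComplexOfCompEqZero i
    (LinearMap.range i).mkQ (LinearMap.range_mkQ_comp i)
  have hS : S.ShortExact :=
    { exact := ModuleCat.shortComplex_exact _ (LinearMap.exact_map_mkQ_range i)
      mono_f := (ModuleCat.mono_iff_injective _).2 fun x y h => hι (congrArg Subtype.val h)
      epi_g := (ModuleCat.epi_iff_surjective _).2 (Submodule.mkQ_surjective _) }
  have hC : IsPowTorsion J S.X₃ :=
    (isPowTorsion_powTorsion E).of_surjective _ (Submodule.mkQ_surjective (LinearMap.range i))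
  rw [ModuleCat.isZero_iff_subsingleton]
  refine subsingleton_of_forall_eq 0 fun h => ?_
  have hz : Subsingleton ((localCohomology J (n + 1)).obj Γ) :=
    ModuleCat.subsingleton_of_isZero (isZero_of_injective Γ n)
  obtain ⟨c, rfl⟩ := (exact_δ_map_f (J := J) hS n h).1 (hz.elim _ _)
  obtain _ | n := n
  -- Degree one: `H⁰` is the identity on power torsion modules, so `H⁰(Γ) → H⁰(Γ / M)` is onto and
  -- the connecting map is zero.
  · refine (exact_map_g_δ (J := J) hS 0 c).2 ?_
    obtain ⟨y, hy⟩ := Submodule.mkQ_surjective (LinearMap.range i) (zeroToSelf J S.X₃ c)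
    obtain ⟨y', hy'⟩ := (zeroToSelf_bijective (M := Γ) (isPowTorsion_powTorsion E)).2 y
    refine ⟨y', zeroToSelf_injective S.X₃ ?_⟩
    rw [zeroToSelf_naturality]
    exact (congrArg _ hy').trans hy
  · have := ModuleCat.subsingleton_of_isZero (ih n (Nat.lt_succ_self n) S.X₃ hC)
    rw [Subsingleton.elim c 0, map_zero]

/-- Each class is killed by some power of `r`, so an injective action of `r` leaves only zero. -/
theorem isZero_of_smul_injective {M : ModuleCat.{u} R} {n : ℕ} {r : R} (hr : r ∈ J)
    (h : ∀ m : (localCohomology J n).obj M, r • m = 0 → m = 0) :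
    IsZero ((localCohomology J n).obj M) := by
  rw [ModuleCat.isZero_iff_subsingleton]
  refine subsingleton_of_forall_eq 0 fun m => ?_
  obtain ⟨k, hk⟩ := isPowTorsion M n m
  have h' : r ^ k • m = 0 := hk _ (Ideal.pow_mem_pow hr k)
  clear hk
  induction k with
  | zero => simpa using h'
  | succ k ih => exact ih (h _ (by rwa [smul_smul, ← pow_succ']))

theorem map_smulShortComplex_f {M : ModuleCat.{u} R} (r : R) (n : ℕ)
    (m : (localCohomology J n).obj M) :
    (localCohomology J n).map (smulShortComplex M r).f m = r • m :=
  congrArg (fun t => t.hom m) (map_smul_id M n r)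

theorem isZero_zero_of_isSMulRegular {M : ModuleCat.{u} R} {r : R} (hr : r ∈ J)
    (reg : IsSMulRegular M r) : IsZero ((localCohomology J 0).obj M) := by
  refine isZero_of_smul_injective hr fun m hm => zeroToSelf_injective M ?_
  rw [map_zero]
  refine reg.right_eq_zero_of_smul ?_
  rw [← map_smul, hm, map_zero]

/-- The kernel of `r` on `Hⁿ⁺¹(M)` is the image of `Hⁿ(M / rM)`. -/
theorem isZero_succ_of_isSMulRegular {M : ModuleCat.{u} R} {r : R} (hr : r ∈ J)
    (reg : IsSMulRegular M r) {n : ℕ}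
    (h : IsZero ((localCohomology J n).obj (ModuleCat.of R (QuotSMulTop r M)))) :
    IsZero ((localCohomology J (n + 1)).obj M) := by
  refine isZero_of_smul_injective hr fun m hm => ?_
  have : Subsingleton ((localCohomology J n).obj (smulShortComplex M r).X₃) :=
    ModuleCat.subsingleton_of_isZero h
  obtain ⟨c, rfl⟩ := (exact_δ_map_f (J := J) reg.smulShortComplex_shortExact n m).1
    ((map_smulShortComplex_f r (n + 1) m).trans hm)
  rw [this.elim c 0]
  exact map_zero (δ J reg.smulShortComplex_shortExact n).hom

/-- `Hⁿ(M / rM)` sits between `Hⁿ(M)` and `Hⁿ⁺¹(M)`; vanishing below `n + 1` thus passes to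
vanishing below `n` for the quotient. -/
theorem isZero_quotSMulTop {M : ModuleCat.{u} R} {r : R} (reg : IsSMulRegular M r) {n : ℕ}
    (h : IsZero ((localCohomology J n).obj M)) (h' : IsZero ((localCohomology J (n + 1)).obj M)) :
    IsZero ((localCohomology J n).obj (ModuleCat.of R (QuotSMulTop r M))) := by
  rw [ModuleCat.isZero_iff_subsingleton]
  refine subsingleton_of_forall_eq 0 fun c => ?_
  have h₁ : Subsingleton ((localCohomology J n).obj (smulShortComplex M r).X₂) :=
    ModuleCat.subsingleton_of_isZero h
  have h₂ : Subsingleton ((localCohomology J (n + 1)).obj (smulShortComplex M r).X₁) :=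
    ModuleCat.subsingleton_of_isZero h'
  obtain ⟨y, rfl⟩ := (exact_map_g_δ (J := J) reg.smulShortComplex_shortExact n c).1
    (h₂.elim _ _)
  rw [h₁.elim y 0]
  exact map_zero ((localCohomology J n).map (smulShortComplex M r).g).hom

theorem isZero_of_isWeaklyRegular {rs : List R} (hrs : ∀ r ∈ rs, r ∈ J) {M : ModuleCat.{u} R}
    (reg : RingTheory.Sequence.IsWeaklyRegular M rs) {n : ℕ} (hn : n < rs.length) :
    IsZero ((localCohomology J n).obj M) := by
  induction rs generalizing M n with
  | nil => simp at hn
  | cons r rs ih =>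
    rw [RingTheory.Sequence.isWeaklyRegular_cons_iff] at reg
    obtain _ | n := n
    · exact isZero_zero_of_isSMulRegular (hrs r (by simp)) reg.1
    · exact isZero_succ_of_isSMulRegular (hrs r (by simp)) reg.1
        (ih (M := ModuleCat.of R (QuotSMulTop r M)) (fun r hr => hrs r (by simp [hr])) reg.2
          (by simpa using hn))

end localCohomology

/-! ### Systems of parameters are regular sequences when low local cohomology vanishes. -/

namespace localCohomology

open ModuleCat Pointwise IsLocalRing

variable {R : Type u} [CommRing R]

/-- A sequence `x₀, x₁, …` indexed by `Fin n` is regular on `M` if `x₀` is regular on `M` and the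
remaining sequence is regular on `M / x₀ M`. -/
def IsRegularSequence : ∀ {n : ℕ}, (Fin n → R) → ModuleCat.{u} R → Prop
  | 0, _, _ => True
  | _ + 1, x, M =>
    IsSMulRegular M (x 0) ∧ IsRegularSequence (Fin.tail x) (ModuleCat.of R (QuotSMulTop (x 0) M))

section Support

variable [IsLocalRing R]

/-- The support of `M` meets the zero locus of `x` in the closed point at most. -/
def IsParameterSystem {ι : Type*} (x : ι → R) (M : Type u) [AddCommGroup M] [Module R M] : Prop :=
  ∀ p ∈ Module.support R M, (∀ s, x s ∈ p.asIdeal) → p.asIdeal = maximalIdeal R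

theorem IsParameterSystem.pow {ι : Type*} {x : ι → R} {M : Type u} [AddCommGroup M] [Module R M]
    (h : IsParameterSystem x M) (n : ℕ) : IsParameterSystem (fun s => x s ^ n) M :=
  fun p hp hx => h p hp fun s => p.2.mem_of_pow_mem n (hx s)

theorem IsParameterSystem.tail {n : ℕ} {x : Fin (n + 1) → R} {M : Type u} [AddCommGroup M]
    [Module R M] [Module.Finite R M] (h : IsParameterSystem x M) :
    IsParameterSystem (Fin.tail x) (QuotSMulTop (x 0) M) := by
  intro p hp hx
  rw [Module.support_quotSMulTop] at hp
  exact h p hp.1 (Fin.cases (hp.2 rfl) hx)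

/-- A prime in the support of `M / (x)M` contains the annihilator of an element, hence a power of
the maximal ideal. -/
theorem isParameterSystem_of_isPowTorsion {n : ℕ} {x : Fin n → R} {M : Type u} [AddCommGroup M]
    [Module R M] [Module.Finite R M]
    (h : IsPowTorsion (maximalIdeal R) (M ⧸ Ideal.span (Set.range x) • (⊤ : Submodule R M))) :
    IsParameterSystem x M := by
  intro p hp hx
  have hp' : p ∈ Module.support R (M ⧸ Ideal.span (Set.range x) • (⊤ : Submodule R M)) := by
    rw [Module.support_quotient]
    refine ⟨hp, ?_⟩
    rw [PrimeSpectrum.zeroLocus_span]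
    rintro _ ⟨s, rfl⟩
    exact hx s
  obtain ⟨m, hm⟩ := Module.mem_support_iff_exists_annihilator.1 hp'
  obtain ⟨k, hk⟩ := h m
  refine le_antisymm (le_maximalIdeal p.2.ne_top) (p.2.le_of_pow_le (n := k) (le_trans ?_ hm))
  intro a ha
  rw [Submodule.mem_annihilator_span_singleton]
  exact hk a ha

/-- The support condition is stable under taking powers of `x` (`IsParameterSystem.pow`), so this
transfers the finiteness known for `x` to all its powers. -/
theorem exists_pow_maximalIdeal_smul_eq_zero [IsNoetherianRing R] {n : ℕ} {x : Fin n → R}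
    {M : Type u} [AddCommGroup M] [Module R M] [Module.Finite R M] (h : IsParameterSystem x M) :
    ∃ k : ℕ, ∀ a ∈ maximalIdeal R ^ k,
      ∀ m : M ⧸ Ideal.span (Set.range x) • (⊤ : Submodule R M), a • m = 0 := by
  have hle : maximalIdeal R ≤
      (Module.annihilator R (M ⧸ Ideal.span (Set.range x) • (⊤ : Submodule R M))).radical := by
    rw [Ideal.radical_eq_sInf]
    refine le_sInf fun p hp => ?_
    have hp' := (Module.mem_support_iff_of_finite (p := ⟨p, hp.2⟩)).2 hp.1
    rw [Module.support_quotient, PrimeSpectrum.zeroLocus_span] at hp'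
    exact (h _ hp'.1 fun s => hp'.2 ⟨s, rfl⟩).ge
  obtain ⟨k, hk⟩ := Ideal.exists_pow_le_of_le_radical_of_fg hle (IsNoetherian.noetherian _)
  exact ⟨k, fun a ha => Module.mem_annihilator.1 (hk ha)⟩

/-- Every simple layer is a copy of the residue field and costs one factor of the maximal ideal. -/
theorem exists_pow_maximalIdeal_smul_eq_zero_of_isFiniteLength {M : Type u} [AddCommGroup M]
    [Module R M] (h : IsFiniteLength R M) :
    ∃ k : ℕ, ∀ a ∈ maximalIdeal R ^ k, ∀ m : M, a • m = 0 := by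
  induction h with
  | of_subsingleton => exact ⟨0, fun _ _ _ => Subsingleton.elim _ _⟩
  | @of_simple_quotient M _ _ N hN _ ih =>
    obtain ⟨k, hk⟩ := ih
    refine ⟨k + 1, fun a ha m => ?_⟩
    rw [pow_succ] at ha
    induction ha using Submodule.mul_induction_on' with
    | mem_mul_mem b hb c hc =>
      have hcm : c • m ∈ N := by
        obtain ⟨I, hI, ⟨e⟩⟩ := isSimpleModule_iff_quot_maximal.1 hN
        rw [← Submodule.Quotient.mk_eq_zero, Submodule.Quotient.mk_smul]
        apply e.injective
        rw [map_smul, map_zero]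
        obtain ⟨y, hy⟩ := Submodule.Quotient.mk_surjective _ (e (Submodule.Quotient.mk m))
        rw [← hy, ← Submodule.Quotient.mk_smul, Submodule.Quotient.mk_eq_zero,
          eq_maximalIdeal hI]
        exact Ideal.mul_mem_right _ _ hc
      rw [mul_smul]
      exact congrArg Subtype.val (hk b hb ⟨c • m, hcm⟩)
    | add b _ c _ hb hc => rw [add_smul, hb, hc, add_zero]

theorem supportDim_le_of_isParameterSystem [IsNoetherianRing R] {n : ℕ} {x : Fin n → R}
    (hx : ∀ s, x s ∈ maximalIdeal R) {M : Type u} [AddCommGroup M] [Module R M] [Module.Finite R M]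
    (h : IsParameterSystem x M) : Module.supportDim R M ≤ n := by
  induction n generalizing M with
  | zero =>
    have : Subsingleton (Module.support R M) := ⟨fun p q => Subtype.ext (PrimeSpectrum.ext
      ((h p.1 p.2 fun s => s.elim0).trans (h q.1 q.2 fun s => s.elim0).symm))⟩
    exact_mod_cast Order.krullDim_nonpos_of_subsingleton
  | succ n ih =>
    refine (Module.supportDim_le_supportDim_quotSMulTop_succ (hx 0)).trans ?_
    rw [Nat.cast_succ]
    exact add_le_add_left (ih (x := Fin.tail x) (fun s => hx s.succ) h.tail) 1

/-- `H⁰ = 0` leaves no nonzero element killed by the maximal ideal, so there are no nonzero maps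
from the residue field to `M`; for finite modules this yields a regular element. -/
theorem exists_isSMulRegular_of_isZero [IsNoetherianRing R] {M : ModuleCat.{u} R}
    [Module.Finite R M] (h : IsZero ((localCohomology (maximalIdeal R) 0).obj M)) :
    ∃ r ∈ maximalIdeal R, IsSMulRegular M r := by
  have : Subsingleton (R ⧸ maximalIdeal R →ₗ[R] M) := by
    refine subsingleton_of_forall_eq 0 fun f => ?_
    have := ModuleCat.subsingleton_of_isZero h
    have h1 : f (Submodule.Quotient.mk 1) = 0 := by
      obtain ⟨y, hy⟩ := mem_range_zeroToSelf (J := maximalIdeal R)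
        (m := f (Submodule.Quotient.mk 1)) (k := 1) (fun a ha => by
          rw [← map_smul, ← Submodule.Quotient.mk_smul, smul_eq_mul, mul_one,
            (Submodule.Quotient.mk_eq_zero _).2 (by simpa using ha), map_zero])
      rw [← hy, Subsingleton.elim y 0, map_zero]
    refine LinearMap.ext fun x => ?_
    obtain ⟨x, rfl⟩ := Submodule.Quotient.mk_surjective _ x
    have : (Submodule.Quotient.mk x : R ⧸ maximalIdeal R) = x • Submodule.Quotient.mk 1 := by
      rw [← Submodule.Quotient.mk_smul, smul_eq_mul, mul_one]
    rw [this, map_smul, h1, smul_zero, LinearMap.zero_apply]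
  obtain ⟨r, hr, hreg⟩ := IsSMulRegular.subsingleton_linearMap_iff.1 this
  rw [Ideal.annihilator_quotient] at hr
  exact ⟨r, hr, hreg⟩

/-- If the local cohomology of `M` vanishes below degree `n`, then all nonzero submodules of `M`
have dimension at least `n`. -/
theorem le_supportDim_of_isZero [IsNoetherianRing R] (n : ℕ) (M : ModuleCat.{u} R)
    [Module.Finite R M] (h : ∀ j < n, IsZero ((localCohomology (maximalIdeal R) j).obj M))
    (N : Submodule R M) (hN : N ≠ ⊥) : (n : WithBot ℕ∞) ≤ Module.supportDim R N := by
  induction n generalizing M with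
  | zero =>
    have : Nontrivial N := (Submodule.nontrivial_iff_ne_bot).2 hN
    have := Module.supportDim_ne_bot_of_nontrivial R N
    obtain ⟨a, ha⟩ := WithBot.ne_bot_iff_exists.1 this
    rw [← ha]
    exact_mod_cast zero_le
  | succ n ih =>
    obtain ⟨y, hy, reg⟩ := exists_isSMulRegular_of_isZero (h 0 n.succ_pos)
    -- The largest submodule with the same annihilator as `N`, hence of the same dimension. Unlike
    -- `N` it is saturated: `y • m ∈ N'` forces `m ∈ N'`. So `N' / yN'` embeds in `M / yM`, where
    -- the induction hypothesis applies.
    let N' : Submodule R M := Submodule.torsionBySet R M (Module.annihilator R N)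
    have hle : N ≤ N' := fun m hm => (Submodule.mem_torsionBySet_iff _ _).2 fun a =>
      congrArg Subtype.val (Module.mem_annihilator.1 a.2 ⟨m, hm⟩)
    have hann : Module.annihilator R N' = Module.annihilator R N := by
      refine le_antisymm ?_ fun a ha => Module.mem_annihilator.2 fun m => Subtype.ext ?_
      · exact LinearMap.annihilator_le_of_injective (Submodule.inclusion hle)
          (Submodule.inclusion_injective hle)
      · exact (Submodule.mem_torsionBySet_iff _ _).1 m.2 ⟨a, ha⟩
    have hdim : Module.supportDim R N = Module.supportDim R N' := by
      rw [Module.supportDim_eq_ringKrullDim_quotient_annihilator,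
        Module.supportDim_eq_ringKrullDim_quotient_annihilator, hann]
    have : Nontrivial N' := by
      have : Nontrivial N := (Submodule.nontrivial_iff_ne_bot).2 hN
      exact (Submodule.inclusion_injective hle).nontrivial
    have : Nontrivial (QuotSMulTop y N') := nontrivial_quotSMulTop_of_mem_maximalIdeal N' hy
    have reg' : IsSMulRegular N' y := reg.submodule N' y
    rw [hdim, ← Module.supportDim_quotSMulTop_succ_eq_supportDim reg' hy, Nat.cast_succ]
    refine add_le_add_left ?_ 1
    let f : QuotSMulTop y N' →ₗ[R] QuotSMulTop y M := QuotSMulTop.map y N'.subtype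
    have hf : Function.Injective f := by
      refine (injective_iff_map_eq_zero f).2 fun c hc => ?_
      obtain ⟨c, rfl⟩ := Submodule.Quotient.mk_surjective _ c
      have hc' : (c : M) ∈ y • (⊤ : Submodule R M) := (Submodule.Quotient.mk_eq_zero _).1 hc
      obtain ⟨m, -, hm⟩ := (Submodule.mem_smul_pointwise_iff_exists _ _ _).1 hc'
      have hm' : m ∈ N' := by
        refine (Submodule.mem_torsionBySet_iff _ _).2 fun a => reg ?_
        change y • (a : R) • m = y • 0
        rw [smul_comm, hm, smul_zero]
        exact (Submodule.mem_torsionBySet_iff _ _).1 c.2 a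
      refine (Submodule.Quotient.mk_eq_zero _).2
        ((Submodule.mem_smul_pointwise_iff_exists _ _ _).2 ⟨⟨m, hm'⟩, trivial, Subtype.ext hm⟩)
    rw [Module.supportDim_eq_of_equiv (LinearEquiv.ofInjective f hf)]
    refine ih (ModuleCat.of R (QuotSMulTop y M)) (fun j hj => ?_) _ ?_
    · exact isZero_quotSMulTop reg (h j (hj.trans n.lt_succ_self)) (h (j + 1) (by omega))
    · rw [Ne, LinearMap.range_eq_bot]
      rintro h0
      obtain ⟨c, hc⟩ := exists_ne (0 : QuotSMulTop y N')
      exact hc (hf (by rw [h0, LinearMap.zero_apply, LinearMap.zero_apply]))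

/-- A system of parameters of length `n` is a regular sequence if the local cohomology vanishes
below degree `n`. -/
theorem isRegularSequence_of_isParameterSystem [IsNoetherianRing R] {n : ℕ} {x : Fin n → R}
    (hx : ∀ s, x s ∈ maximalIdeal R) (M : ModuleCat.{u} R) [Module.Finite R M]
    (hp : IsParameterSystem x M)
    (h : ∀ j < n, IsZero ((localCohomology (maximalIdeal R) j).obj M)) :
    IsRegularSequence x M := by
  induction n generalizing M with
  | zero => trivial
  | succ n ih =>
    have reg : IsSMulRegular M (x 0) := by
      rw [isSMulRegular_iff_ker_lsmul_eq_bot]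
      -- A nonzero kernel of `x 0` would have dimension at least `n + 1` by the vanishing, but at
      -- most `n`, since `x 0` kills it and the other `n` elements are parameters on it.
      by_contra hN
      have h₁ := le_supportDim_of_isZero (n + 1) M h _ hN
      have h₂ : Module.supportDim R (LinearMap.ker (LinearMap.lsmul R M (x 0))) ≤ n := by
        refine supportDim_le_of_isParameterSystem (x := Fin.tail x) (fun s => hx s.succ) ?_
        intro p hp' hxp
        refine hp p (Module.support_subset_of_injective (Submodule.subtype _)
          (Submodule.subtype_injective _) hp') (Fin.cases ?_ hxp)
        refine Module.mem_support_iff_of_finite.1 hp' (Module.mem_annihilator.2 fun m => ?_)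
        exact Subtype.ext m.2
      have := h₁.trans h₂
      norm_cast at this
      omega
    refine ⟨reg, ih (fun s => hx s.succ) (ModuleCat.of R (QuotSMulTop (x 0) M)) hp.tail
      fun j hj => ?_⟩
    exact isZero_quotSMulTop reg (h j (hj.trans n.lt_succ_self)) (h (j + 1) (by omega))

end Support

end localCohomology

/-! ### Top local cohomology through a regular sequence. -/

namespace localCohomology

open ModuleCat Pointwise

variable {R : Type u} [CommRing R] {J : Ideal R}

/-- A sequence is coregular on `X` if `x₀` is surjective on `X` and the remaining sequence is
coregular on the kernel of `x₀`. -/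
def IsCoregularSequence : ∀ {n : ℕ}, (Fin n → R) → ∀ (X : Type u) [AddCommGroup X] [Module R X],
    Prop
  | 0, _, _, _, _ => True
  | _ + 1, x, X, _, _ => Function.Surjective (LinearMap.lsmul R X (x 0)) ∧
    IsCoregularSequence (Fin.tail x) (LinearMap.ker (LinearMap.lsmul R X (x 0)))

theorem IsCoregularSequence.of_linearEquiv {n : ℕ} {x : Fin n → R} {X Y : Type u}
    [AddCommGroup X] [Module R X] [AddCommGroup Y] [Module R Y] (e : X ≃ₗ[R] Y)
    (h : IsCoregularSequence x X) : IsCoregularSequence x Y := by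
  induction n generalizing X Y with
  | zero => trivial
  | succ n ih =>
    refine ⟨fun y => ?_, ih (LinearEquiv.ofSubmodules e _ _ ?_) h.2⟩
    · obtain ⟨z, hz⟩ := h.1 (e.symm y)
      refine ⟨e z, ?_⟩
      rw [LinearMap.lsmul_apply] at hz ⊢
      rw [← map_smul, hz, e.apply_symm_apply]
    · ext y
      simp only [Submodule.mem_map, LinearMap.mem_ker, LinearMap.lsmul_apply]
      constructor
      · rintro ⟨z, hz, rfl⟩
        change x 0 • e z = 0
        rw [← map_smul, hz, map_zero]
      · intro hy
        exact ⟨e.symm y, by rw [← map_smul, hy, map_zero], e.apply_symm_apply y⟩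

variable (J) in
/-- The inverse of the isomorphism `H⁰(M) ≅ M` for power torsion modules. -/
def selfToZero (M : ModuleCat.{u} R) : M →ₗ[R] (localCohomology J 0).obj M :=
  open Classical in
  -- The default value zero lets `toTop` be defined by recursion without carrying proofs;
  -- `quotConnecting` is treated likewise.
  if h : IsPowTorsion J M then
    (LinearEquiv.ofBijective (zeroToSelf J M).hom (zeroToSelf_bijective h)).symm.toLinearMap
  else 0

theorem zeroToSelf_selfToZero {M : ModuleCat.{u} R} (hM : IsPowTorsion J M) (m : M) :
    zeroToSelf J M (selfToZero J M m) = m := by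
  rw [selfToZero, dif_pos hM]
  exact (LinearEquiv.ofBijective (zeroToSelf J M).hom (zeroToSelf_bijective hM)).apply_symm_apply m

variable (J) in
/-- The connecting map `Hⁿ(M / r M) → Hⁿ⁺¹(M)`, if `r` is regular on `M`. -/
def quotConnecting (M : ModuleCat.{u} R) (r : R) (n : ℕ) :
    (localCohomology J n).obj (ModuleCat.of R (QuotSMulTop r M)) →ₗ[R]
      (localCohomology J (n + 1)).obj M :=
  open Classical in
  if h : IsSMulRegular M r then (δ J h.smulShortComplex_shortExact n).hom else 0

theorem quotConnecting_eq {M : ModuleCat.{u} R} {r : R} (h : IsSMulRegular M r) (n : ℕ) :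
    quotConnecting J M r n = (δ J h.smulShortComplex_shortExact n).hom :=
  dif_pos h

theorem exact_quotConnecting_smul {M : ModuleCat.{u} R} {r : R} (h : IsSMulRegular M r) (n : ℕ) :
    Function.Exact (quotConnecting J M r n)
      (LinearMap.lsmul R ((localCohomology J (n + 1)).obj M) r) := by
  intro c
  rw [quotConnecting_eq h]
  have := exact_δ_map_f (J := J) h.smulShortComplex_shortExact n c
  exact (Iff.of_eq (congrArg (· = 0) (map_smulShortComplex_f r (n + 1) c))).symm.trans this

theorem quotConnecting_injective {M : ModuleCat.{u} R} {r : R} (h : IsSMulRegular M r) {n : ℕ}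
    (hn : IsZero ((localCohomology J n).obj M)) :
    Function.Injective (quotConnecting J M r n) := by
  refine (injective_iff_map_eq_zero _).2 fun c hc => ?_
  rw [quotConnecting_eq h] at hc
  obtain ⟨y, rfl⟩ := (exact_map_g_δ (J := J) h.smulShortComplex_shortExact n c).1 hc
  have : Subsingleton ((localCohomology J n).obj (smulShortComplex M r).X₂) :=
    ModuleCat.subsingleton_of_isZero hn
  rw [this.elim y 0]
  exact map_zero ((localCohomology J n).map (smulShortComplex M r).g).hom

theorem lsmul_surjective {M : ModuleCat.{u} R} {r : R} (h : IsSMulRegular M r) {n : ℕ}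
    (hn : IsZero ((localCohomology J n).obj (ModuleCat.of R (QuotSMulTop r M)))) :
    Function.Surjective (LinearMap.lsmul R ((localCohomology J n).obj M) r) := by
  intro c
  have : Subsingleton ((localCohomology J n).obj (smulShortComplex M r).X₃) :=
    ModuleCat.subsingleton_of_isZero hn
  obtain ⟨y, hy⟩ := (exact_map_f_map_g (J := J) h.smulShortComplex_shortExact n c).1
    (this.elim _ _)
  exact ⟨y, (map_smulShortComplex_f r n y).symm.trans hy⟩

/-- The map on quotients induced by `f` if `f` maps `r M` to `s N`. -/
def quotMap {M N : ModuleCat.{u} R} (f : M ⟶ N) {r s a : R} (h : r = a * s) :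
    ModuleCat.of R (QuotSMulTop r M) ⟶ ModuleCat.of R (QuotSMulTop s N) :=
  ModuleCat.ofHom (Submodule.mapQ _ _ f.hom (by
    intro m hm
    obtain ⟨m, -, rfl⟩ := (Submodule.mem_smul_pointwise_iff_exists _ _ _).1 hm
    refine (Submodule.mem_smul_pointwise_iff_exists _ _ _).2 ⟨a • f m, trivial, ?_⟩
    subst h
    rw [map_smul, smul_smul, mul_comm]))

/-- For `f` to commute with `r` and `s` where `r = a * s`, the map on the left-hand terms must be `a
• f`; this is the source of the factor `a`. -/
theorem quotConnecting_quotMap {M N : ModuleCat.{u} R} (f : M ⟶ N) {r s a : R} (h : r = a * s)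
    (hr : IsSMulRegular M r) (hs : IsSMulRegular N s) (n : ℕ)
    (c : (localCohomology J n).obj (ModuleCat.of R (QuotSMulTop r M))) :
    quotConnecting J N s n ((localCohomology J n).map (quotMap f h) c) =
      a • (localCohomology J (n + 1)).map f (quotConnecting J M r n c) := by
  rw [quotConnecting_eq hs, quotConnecting_eq hr]
  let τ : smulShortComplex M r ⟶ smulShortComplex N s :=
    { τ₁ := a • f
      τ₂ := f
      τ₃ := quotMap f h
      comm₁₂ := by
        ext m
        refine Eq.trans ?_ (f.hom.map_smul r m).symm
        change s • a • f.hom m = r • f.hom m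
        rw [h, smul_smul, mul_comm]
      comm₂₃ := rfl }
  refine (δ_naturality (J := J) hr.smulShortComplex_shortExact hs.smulShortComplex_shortExact τ n
    c).trans ?_
  exact congrArg (fun t => t.hom (δ J hr.smulShortComplex_shortExact n c))
    (map_smul_hom (n + 1) a f)

variable (J) in
/-- The iterated connecting map from `M` to its top local cohomology, for a regular sequence. -/
def toTop : ∀ {n : ℕ} (_ : Fin n → R) (M : ModuleCat.{u} R),
    M →ₗ[R] (localCohomology J n).obj M
  | 0, _, M => selfToZero J M
  | n + 1, x, M => quotConnecting J M (x 0) n ∘ₗ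
      toTop (Fin.tail x) (ModuleCat.of R (QuotSMulTop (x 0) M)) ∘ₗ (Submodule.mkQ _)

theorem mem_span_range_smul_top_iff {n : ℕ} (x : Fin (n + 1) → R) {M : Type u} [AddCommGroup M]
    [Module R M] (m : M) :
    m ∈ Ideal.span (Set.range x) • (⊤ : Submodule R M) ↔
      (Submodule.Quotient.mk m : QuotSMulTop (x 0) M) ∈
        Ideal.span (Set.range (Fin.tail x)) • (⊤ : Submodule R (QuotSMulTop (x 0) M)) := by
  have h₁ : Ideal.span (Set.range x) = Ideal.span {x 0} ⊔ Ideal.span (Set.range (Fin.tail x)) := by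
    rw [← Ideal.span_union]
    congr 1
    ext a
    constructor
    · rintro ⟨s, rfl⟩
      exact Fin.cases (Or.inl rfl) (fun s => Or.inr ⟨s, rfl⟩) s
    · rintro (rfl | ⟨s, rfl⟩)
      exacts [⟨0, rfl⟩, ⟨s.succ, rfl⟩]
  have h₂ : Ideal.span (Set.range (Fin.tail x)) • (⊤ : Submodule R (QuotSMulTop (x 0) M)) =
      (Ideal.span (Set.range (Fin.tail x)) • (⊤ : Submodule R M)).map
        (Submodule.mkQ (x 0 • (⊤ : Submodule R M))) := by
    rw [Submodule.map_smul'', Submodule.map_top, Submodule.range_mkQ]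
  rw [h₁, Submodule.sup_smul, h₂, ← Submodule.mkQ_apply, ← Submodule.mem_comap,
    Submodule.comap_map_mkQ, Submodule.ideal_span_singleton_smul]

theorem IsPowTorsion.tail {n : ℕ} {x : Fin (n + 1) → R} {M : Type u} [AddCommGroup M] [Module R M]
    (h : IsPowTorsion J (M ⧸ Ideal.span (Set.range x) • (⊤ : Submodule R M))) :
    IsPowTorsion J (QuotSMulTop (x 0) M ⧸
      Ideal.span (Set.range (Fin.tail x)) • (⊤ : Submodule R (QuotSMulTop (x 0) M))) := by
  intro c
  obtain ⟨c, rfl⟩ := Submodule.Quotient.mk_surjective _ c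
  obtain ⟨m, rfl⟩ := Submodule.Quotient.mk_surjective _ c
  obtain ⟨k, hk⟩ := h (Submodule.Quotient.mk m)
  refine ⟨k, fun a ha => ?_⟩
  have := hk a ha
  rw [← Submodule.Quotient.mk_smul, Submodule.Quotient.mk_eq_zero,
    mem_span_range_smul_top_iff] at this
  rwa [← Submodule.Quotient.mk_smul, Submodule.Quotient.mk_eq_zero, ← Submodule.Quotient.mk_smul]

theorem IsPowTorsion.of_fin_zero {x : Fin 0 → R} {M : Type u} [AddCommGroup M] [Module R M]
    (h : IsPowTorsion J (M ⧸ Ideal.span (Set.range x) • (⊤ : Submodule R M))) :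
    IsPowTorsion J M := by
  have h₀ : Ideal.span (Set.range x) • (⊤ : Submodule R M) = ⊥ := by
    rw [Set.range_eq_empty, Ideal.span_empty, Submodule.bot_smul]
  exact h.of_surjective (Submodule.quotEquivOfEqBot _ h₀).toLinearMap
    (Submodule.quotEquivOfEqBot _ h₀).surjective

/-- A regular sequence with power torsion quotient computes local cohomology. -/
theorem toTop_spec [IsNoetherianRing R] {n : ℕ} {x : Fin n → R} (hx : ∀ s, x s ∈ J)
    {M : ModuleCat.{u} R} (hreg : IsRegularSequence x M)
    (ht : IsPowTorsion J (M ⧸ Ideal.span (Set.range x) • (⊤ : Submodule R M))) :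
    (∀ j, j ≠ n → IsZero ((localCohomology J j).obj M)) ∧
    IsCoregularSequence x ((localCohomology J n).obj M) ∧
    (∀ m : M, toTop J x M m = 0 ↔ m ∈ Ideal.span (Set.range x) • (⊤ : Submodule R M)) ∧
    (∀ c : (localCohomology J n).obj M, (∀ s, x s • c = 0) ↔ ∃ m, toTop J x M m = c) := by
  induction n generalizing M with
  | zero =>
    have h₀ : Ideal.span (Set.range x) • (⊤ : Submodule R M) = ⊥ := by
      rw [Set.range_eq_empty, Ideal.span_empty, Submodule.bot_smul]
    have hM := ht.of_fin_zero
    refine ⟨fun j hj => ?_, trivial, fun m => ?_, fun c => ?_⟩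
    · obtain ⟨j, rfl⟩ := Nat.exists_eq_succ_of_ne_zero hj
      exact isZero_succ_of_isPowTorsion j M hM
    · rw [h₀, Submodule.mem_bot]
      constructor
      · intro h
        have := zeroToSelf_selfToZero hM m
        rw [← this]
        exact (congrArg (zeroToSelf J M) h).trans (map_zero _)
      · rintro rfl
        exact map_zero _
    · exact ⟨fun _ => ⟨zeroToSelf J M c, zeroToSelf_injective M (zeroToSelf_selfToZero hM _)⟩,
        fun _ s => s.elim0⟩
  | succ n ih =>
    let M' := ModuleCat.of R (QuotSMulTop (x 0) M)
    have ht' := ht.tail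
    obtain ⟨h₁, h₂, h₃, h₄⟩ := ih (x := Fin.tail x) (fun s => hx s.succ) hreg.2 ht'
    have hz : ∀ j, j ≠ n + 1 → IsZero ((localCohomology J j).obj M) := by
      intro j hj
      obtain _ | j := j
      · exact isZero_zero_of_isSMulRegular (hx 0) hreg.1
      · exact isZero_succ_of_isSMulRegular (hx 0) hreg.1 (h₁ j (by omega))
    -- As `Hⁿ(M) = 0`, the connecting map identifies `Hⁿ(M / x₀M)` with the kernel of `x₀` on
    -- `Hⁿ⁺¹(M)`; the induction hypotheses are transported along it.
    have hinj := quotConnecting_injective hreg.1 (hz n (by omega))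
    have hex := exact_quotConnecting_smul (J := J) hreg.1 n
    refine ⟨hz, ⟨lsmul_surjective hreg.1 (h₁ (n + 1) (by omega)), ?_⟩, fun m => ?_, fun c => ?_⟩
    · refine h₂.of_linearEquiv ((LinearEquiv.ofInjective _ hinj).trans (LinearEquiv.ofEq _ _ ?_))
      exact hex.linearMap_ker_eq.symm
    · rw [mem_span_range_smul_top_iff, ← h₃]
      change quotConnecting J M (x 0) n (toTop J (Fin.tail x) M' (Submodule.Quotient.mk m)) = 0 ↔ _
      exact map_eq_zero_iff _ hinj
    · constructor
      · intro hc
        obtain ⟨c', rfl⟩ := (hex c).1 (hc 0)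
        obtain ⟨m', rfl⟩ := (h₄ c').1 fun s => hinj (by
          rw [map_smul, map_zero]
          exact hc s.succ)
        obtain ⟨m, rfl⟩ := Submodule.Quotient.mk_surjective _ m'
        exact ⟨m, rfl⟩
      · rintro ⟨m, rfl⟩
        refine Fin.cases ?_ fun s => ?_
        · exact (hex _).2 ⟨_, rfl⟩
        · change x s.succ • quotConnecting J M (x 0) n
            (toTop J (Fin.tail x) M' (Submodule.Quotient.mk m)) = 0
          rw [← map_smul]
          have := (h₄ (toTop J (Fin.tail x) M' (Submodule.Quotient.mk m))).2 ⟨_, rfl⟩ s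
          exact (congrArg _ this).trans (map_zero _)

/-- Each connecting map contributes one factor `a s`. With `f` the identity, the product is exactly
the Koszul transition map in top degree. -/
theorem toTop_naturality {n : ℕ} {x y a : Fin n → R} (hxy : ∀ s, y s = a s * x s)
    {M N : ModuleCat.{u} R} (f : M ⟶ N) (hy : IsRegularSequence y M) (hx : IsRegularSequence x N)
    (hM : IsPowTorsion J (M ⧸ Ideal.span (Set.range y) • (⊤ : Submodule R M)))
    (hN : IsPowTorsion J (N ⧸ Ideal.span (Set.range x) • (⊤ : Submodule R N))) (m : M) :
    toTop J x N (f m) = (∏ s, a s) • (localCohomology J n).map f (toTop J y M m) := by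
  induction n generalizing M N with
  | zero =>
    refine zeroToSelf_injective N ?_
    rw [Finset.univ_eq_empty, Finset.prod_empty, one_smul, zeroToSelf_naturality]
    exact (zeroToSelf_selfToZero hN.of_fin_zero _).trans
      (congrArg f (zeroToSelf_selfToZero hM.of_fin_zero m)).symm
  | succ n ih =>
    have := ih (x := Fin.tail x) (y := Fin.tail y) (a := Fin.tail a) (fun s => hxy s.succ)
      (quotMap f (hxy 0)) hy.2 hx.2 hM.tail hN.tail
      (Submodule.Quotient.mk m)
    change quotConnecting J N (x 0) n (toTop J (Fin.tail x) _
      (quotMap f (hxy 0) (Submodule.Quotient.mk m))) = _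
    rw [this, map_smul, quotConnecting_quotMap f (hxy 0) hy.1 hx.1, Fin.prod_univ_succ, smul_smul,
      mul_comm]
    rfl

end localCohomology

/-! ### Acyclicity of the Koszul complex of a coregular sequence below the top degree. -/

namespace LocalHomology

open localCohomology

variable {R : Type u} [CommRing R]

section Total

variable {X : Type v} [AddCommGroup X] [Module R X]

/-- The total Koszul differential, on families indexed by all subsets. -/
def totalD {r : ℕ} (x : Fin r → R) (X : Type v) [AddCommGroup X] [Module R X] :
    (Finset (Fin r) → X) →ₗ[R] (Finset (Fin r) → X) where
  toFun f S := ∑ s, if s ∈ S then 0 else (koszulSign S s * x s) • f (insert s S)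
  map_add' f g := by
    funext S
    rw [Pi.add_apply, ← Finset.sum_add_distrib]
    refine Finset.sum_congr rfl fun s _ => ?_
    split_ifs <;> simp
  map_smul' a f := by
    funext S
    rw [Pi.smul_apply, RingHom.id_apply, Finset.smul_sum]
    refine Finset.sum_congr rfl fun s _ => ?_
    split_ifs
    · simp
    · exact smul_comm _ _ _

theorem totalD_apply {r : ℕ} (x : Fin r → R) (f : Finset (Fin r) → X) (S : Finset (Fin r)) :
    totalD x X f S = ∑ s, if s ∈ S then 0 else (koszulSign S s * x s) • f (insert s S) :=
  rfl

theorem map_totalD {r : ℕ} (x : Fin r → R) {Y : Type*} [AddCommGroup Y] [Module R Y]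
    (φ : X →ₗ[R] Y) (f : Finset (Fin r) → X) (S : Finset (Fin r)) :
    φ (totalD x X f S) = totalD x Y (fun T => φ (f T)) S := by
  rw [totalD_apply, totalD_apply, map_sum]
  refine Finset.sum_congr rfl fun s _ => ?_
  split_ifs <;> simp

theorem totalD_univ {r : ℕ} (x : Fin r → R) (f : Finset (Fin r) → X) :
    totalD x X f Finset.univ = 0 :=
  (totalD_apply x f _).trans (Finset.sum_eq_zero fun s _ => if_pos (Finset.mem_univ s))

/-- The image of a subset of `Fin n` in `Fin (n + 1)` under the successor map. -/
abbrev shift {n : ℕ} (S : Finset (Fin n)) : Finset (Fin (n + 1)) := S.map (Fin.succEmb n)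

theorem zero_notMem_shift {n : ℕ} (S : Finset (Fin n)) : (0 : Fin (n + 1)) ∉ shift S := by
  simp [shift]

theorem succ_mem_shift {n : ℕ} {S : Finset (Fin n)} {s : Fin n} : s.succ ∈ shift S ↔ s ∈ S :=
  Finset.mem_map' (Fin.succEmb n)

theorem card_filter_shift {n : ℕ} (S : Finset (Fin n)) (s : Fin n) :
    ((shift S).filter (· < s.succ)).card = (S.filter (· < s)).card := by
  rw [shift, Finset.filter_map, Finset.card_map]
  congr 1
  ext t
  simp [Function.comp_def]

/-- With `totalD_insert_shift`, this exhibits the complex as the cone of `x 0` on the complex of the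
remaining elements. As `0` precedes every other index, adding it to a subset flips all other signs.
-/
theorem totalD_shift {n : ℕ} (x : Fin (n + 1) → R) (f : Finset (Fin (n + 1)) → X)
    (S : Finset (Fin n)) :
    totalD x X f (shift S) = x 0 • f (insert 0 (shift S)) +
      totalD (Fin.tail x) X (fun T => f (shift T)) S := by
  rw [totalD_apply, Fin.sum_univ_succ, if_neg (zero_notMem_shift S)]
  congr 1
  · have : koszulSign (R := R) (shift S) 0 = 1 := by simp [koszulSign]
    rw [this, one_mul]
  · rw [totalD_apply]
    refine Finset.sum_congr rfl fun s _ => ?_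
    simp only [succ_mem_shift]
    refine if_congr Iff.rfl rfl ?_
    rw [koszulSign, card_filter_shift]
    simp only [shift, Finset.map_insert]
    rfl

theorem totalD_insert_shift {n : ℕ} (x : Fin (n + 1) → R) (f : Finset (Fin (n + 1)) → X)
    (S : Finset (Fin n)) :
    totalD x X f (insert 0 (shift S)) =
      -totalD (Fin.tail x) X (fun T => f (insert 0 (shift T))) S := by
  rw [totalD_apply, Fin.sum_univ_succ, if_pos (Finset.mem_insert_self _ _), zero_add, totalD_apply,
    ← Finset.sum_neg_distrib]
  refine Finset.sum_congr rfl fun s _ => ?_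
  have hmem : s.succ ∈ insert 0 (shift S) ↔ s ∈ S := by
    rw [Finset.mem_insert, succ_mem_shift]
    simp
  simp only [hmem]
  split_ifs with hs
  · simp
  · have hsign : koszulSign (R := R) (insert 0 (shift S)) s.succ = -koszulSign S s := by
      rw [koszulSign, Finset.filter_insert, if_pos s.succ_pos, Finset.card_insert_of_notMem
        (fun h => zero_notMem_shift S (Finset.mem_of_mem_filter _ h)), card_filter_shift, pow_succ,
        koszulSign]
      ring
    rw [hsign, neg_mul, neg_smul, Finset.insert_comm]
    simp only [shift, Finset.map_insert]
    rfl

theorem exists_eq_shift {n : ℕ} (S : Finset (Fin (n + 1))) :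
    (∃ T, S = shift T) ∨ ∃ T, S = insert 0 (shift T) := by
  by_cases h : (0 : Fin (n + 1)) ∈ S
  · refine Or.inr ⟨Finset.univ.filter fun t => t.succ ∈ S, ?_⟩
    ext s
    refine Fin.cases (by simp [h]) (fun s => ?_) s
    rw [Finset.mem_insert, succ_mem_shift]
    simp
  · refine Or.inl ⟨Finset.univ.filter fun t => t.succ ∈ S, ?_⟩
    ext s
    refine Fin.cases (by simp [h]) (fun s => ?_) s
    rw [succ_mem_shift]
    simp

omit [AddCommGroup X] in
theorem funext_shift {n : ℕ} {f g : Finset (Fin (n + 1)) → X} (h₁ : ∀ S, f (shift S) = g (shift S))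
    (h₂ : ∀ S, f (insert 0 (shift S)) = g (insert 0 (shift S))) : f = g := by
  funext S
  obtain ⟨T, rfl⟩ | ⟨T, rfl⟩ := exists_eq_shift S
  exacts [h₁ T, h₂ T]

/-- The family with given values on the subsets with and without `0`. -/
def glue {n : ℕ} (u v : Finset (Fin n) → X) (S : Finset (Fin (n + 1))) : X :=
  if 0 ∈ S then v (Finset.univ.filter fun t => t.succ ∈ S)
  else u (Finset.univ.filter fun t => t.succ ∈ S)

omit [AddCommGroup X] in
theorem glue_shift {n : ℕ} (u v : Finset (Fin n) → X) (S : Finset (Fin n)) :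
    glue u v (shift S) = u S := by
  rw [glue, if_neg (zero_notMem_shift S)]
  congr 1
  ext s
  simp

omit [AddCommGroup X] in
theorem glue_insert_shift {n : ℕ} (u v : Finset (Fin n) → X) (S : Finset (Fin n)) :
    glue u v (insert 0 (shift S)) = v S := by
  rw [glue, if_pos (Finset.mem_insert_self _ _)]
  congr 1
  ext s
  simp

theorem totalD_totalD {r : ℕ} (x : Fin r → R) (f : Finset (Fin r) → X) :
    totalD x X (totalD x X f) = 0 := by
  induction r with
  | zero =>
    funext S
    rw [Subsingleton.elim S Finset.univ]
    exact totalD_univ x _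
  | succ n ih =>
    refine funext_shift (fun S => ?_) fun S => ?_
    · rw [totalD_shift, totalD_insert_shift]
      have : (fun T => totalD x X f (shift T)) = x 0 • (fun T => f (insert 0 (shift T))) +
          totalD (Fin.tail x) X (fun T => f (shift T)) := funext fun T => totalD_shift x f T
      rw [this, map_add, map_smul, ih]
      simp
    · rw [totalD_insert_shift]
      have : (fun T => totalD x X f (insert 0 (shift T))) =
          -totalD (Fin.tail x) X (fun T => f (insert 0 (shift T))) :=
        funext fun T => totalD_insert_shift x f T
      rw [this, map_neg, ih]
      simp

end Total

section Koszul

/-- Surjectivity of `x 0` allows subtracting a boundary so that the components at subsets without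
`0` vanish. The others then form a cycle `v` with values in the kernel of `x 0`, where induction
applies. Using all subsets at once avoids bookkeeping of degrees; `hf'` excludes the top degree. -/
theorem exists_totalD_eq {r : ℕ} {x : Fin r → R} {X : Type u} [AddCommGroup X] [Module R X]
    (hx : IsCoregularSequence x X) {f : Finset (Fin r) → X} (hf : totalD x X f = 0)
    (hf' : f Finset.univ = 0) : ∃ g, totalD x X g = f := by
  induction r generalizing X with
  | zero =>
    refine ⟨0, funext fun S => ?_⟩
    rw [Subsingleton.elim S Finset.univ, hf', totalD_univ]
  | succ n ih =>
    choose q hq using hx.1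
    let w : Finset (Fin n) → X := fun S => q (f (shift S))
    have hw : ∀ S, x 0 • w S = f (shift S) := fun S => hq _
    have h₁ : ∀ S, x 0 • f (insert 0 (shift S)) +
        totalD (Fin.tail x) X (fun T => f (shift T)) S = 0 := fun S => by
      rw [← totalD_shift, hf, Pi.zero_apply]
    have h₂ : totalD (Fin.tail x) X (fun T => f (insert 0 (shift T))) = 0 := funext fun S => by
      rw [Pi.zero_apply, ← neg_eq_zero, ← totalD_insert_shift, hf, Pi.zero_apply]
    let v : Finset (Fin n) → X := fun S => f (insert 0 (shift S)) + totalD (Fin.tail x) X w S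
    have hv : ∀ S, v S ∈ LinearMap.ker (LinearMap.lsmul R X (x 0)) := fun S => by
      rw [LinearMap.mem_ker, LinearMap.lsmul_apply, smul_add, ← LinearMap.lsmul_apply (x 0)
        (totalD (Fin.tail x) X w S), map_totalD]
      simp only [LinearMap.lsmul_apply, hw]
      exact h₁ S
    let v' : Finset (Fin n) → LinearMap.ker (LinearMap.lsmul R X (x 0)) := fun S => ⟨v S, hv S⟩
    obtain ⟨w', hw'⟩ := ih (x := Fin.tail x) hx.2 (f := v') (by
      funext S
      apply Subtype.ext
      rw [← Submodule.subtype_apply, map_totalD]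
      change totalD (Fin.tail x) X ((fun T => f (insert 0 (shift T))) +
        totalD (Fin.tail x) X w) S = 0
      rw [map_add, h₂, totalD_totalD]
      simp) (by
      apply Subtype.ext
      change f (insert 0 (shift Finset.univ)) + totalD (Fin.tail x) X w Finset.univ = 0
      have huniv : insert 0 (shift Finset.univ) = (Finset.univ : Finset (Fin (n + 1))) := by
        ext s
        refine Fin.cases (by simp) (fun s => by simp) s
      rw [totalD_univ, add_zero, huniv, hf'])
    -- Since `x 0` kills `w'`, subtracting it leaves the components without `0` unchanged, while it
    -- adds the required `v` to the others.
    refine ⟨glue 0 (w - fun S => (w' S : X)), funext_shift (fun S => ?_) fun S => ?_⟩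
    · rw [totalD_shift, glue_insert_shift]
      simp only [glue_shift]
      have : totalD (Fin.tail x) X (fun T => (0 : Finset (Fin n) → X) T) = 0 := map_zero _
      rw [this, Pi.sub_apply, smul_sub, hw, Pi.zero_apply, add_zero]
      have := (w' S).2
      rw [LinearMap.mem_ker, LinearMap.lsmul_apply] at this
      rw [this, sub_zero]
    · rw [totalD_insert_shift]
      simp only [glue_insert_shift]
      have h₃ : totalD (Fin.tail x) X (fun T => (w' T : X)) S = v S := by
        have := map_totalD (Fin.tail x) (Submodule.subtype _) w' S
        rw [hw'] at this
        exact this.symm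
      change -totalD (Fin.tail x) X (w - fun T => (w' T : X)) S = _
      rw [map_sub, Pi.sub_apply, h₃]
      simp [v]

variable {r : ℕ} {x : Fin r → R} {X : Type u} [AddCommGroup X] [Module R X]

/-- Extension by zero of a Koszul chain to all subsets. -/
def extendZero (i : ℕ) (f : KoszulX r X i) (S : Finset (Fin r)) : X :=
  if h : S.card = i then f ⟨S, h⟩ else 0

theorem sum_notMem_eq {i : ℕ} (S : {S : Finset (Fin r) // S.card = i}) (F : Fin r → X) :
    ∑ s : {s // s ∉ S.1}, F s = ∑ s, if s ∈ S.1 then 0 else F s := by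
  simp_rw [← ite_not (p := _ ∈ S.1)]
  rw [← Finset.sum_filter, ← Finset.sum_subtype]
  simp

theorem totalD_extendZero (i : ℕ) (f : KoszulX r X (i + 1)) :
    totalD x X (extendZero (i + 1) f) = extendZero i (koszulD x X i f) := by
  funext S
  by_cases h : S.card = i
  · rw [extendZero, dif_pos h, totalD_apply]
    refine Eq.trans (sum_notMem_eq ⟨S, h⟩ fun s =>
      (koszulSign S s * x s) • extendZero (i + 1) f (insert s S)).symm ?_
    · refine Finset.sum_congr rfl fun s _ => ?_
      congr 1
      exact dif_pos (insertIndex ⟨S, h⟩ s).2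
  · rw [extendZero, dif_neg h, totalD_apply]
    refine Finset.sum_eq_zero fun s _ => ?_
    split_ifs with hs
    · rfl
    · rw [extendZero, dif_neg, smul_zero]
      rw [Finset.card_insert_of_notMem hs]
      omega

theorem totalD_extendZero_zero (f : KoszulX r X 0) : totalD x X (extendZero 0 f) = 0 := by
  funext S
  rw [totalD_apply]
  refine Finset.sum_eq_zero fun s _ => ?_
  split_ifs with hs
  · rfl
  · rw [extendZero, dif_neg, smul_zero]
    rw [Finset.card_insert_of_notMem hs]
    omega

theorem koszulD_restrict (i : ℕ) (g : Finset (Fin r) → X) :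
    koszulD x X i (fun S => g S.1) = fun S => totalD x X g S.1 :=
  funext fun S => sum_notMem_eq S fun s => (koszulSign S.1 s * x s) • g (insert s S.1)

theorem exists_koszulD_eq (hx : IsCoregularSequence x X) {i : ℕ} (hi : i ≠ r) {f : KoszulX r X i}
    (hf : totalD x X (extendZero i f) = 0) : ∃ g, koszulD x X i g = f := by
  obtain ⟨g, hg⟩ := exists_totalD_eq hx hf (dif_neg fun h => hi (by rw [← h]; simp))
  refine ⟨fun S => g S.1, ?_⟩
  rw [koszulD_restrict, hg]
  funext S
  exact dif_pos S.2

/-- The Koszul homology of a coregular sequence vanishes outside the top degree. -/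
theorem isZero_koszulHomology (hx : IsCoregularSequence x X) {i : ℕ} (hi : i ≠ r) :
    IsZero ((koszulComplex x X).homology i) := by
  rw [← HomologicalComplex.exactAt_iff_isZero_homology]
  obtain _ | i := i
  · rw [HomologicalComplex.exactAt_iff' _ 1 0 0 (by simp) (by simp),
      ShortComplex.moduleCat_exact_iff]
    intro f _
    obtain ⟨g, hg⟩ := exists_koszulD_eq (x := x) hx hi (totalD_extendZero_zero f)
    refine ⟨g, Eq.trans ?_ hg⟩
    exact congrArg (fun t => t.hom g) (koszulComplex_d x X 0)
  · rw [HomologicalComplex.exactAt_iff' _ (i + 2) (i + 1) i (by simp) (by simp),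
      ShortComplex.moduleCat_exact_iff]
    intro (f : KoszulX r X (i + 1)) hf
    have hf' : koszulD x X i f = 0 :=
      (congrArg (fun t => t.hom f) (koszulComplex_d x X i)).symm.trans hf
    obtain ⟨g, hg⟩ := exists_koszulD_eq (x := x) hx hi (f := f) (by
      rw [totalD_extendZero, hf']
      funext S
      simp [extendZero])
    refine ⟨g, Eq.trans ?_ hg⟩
    exact congrArg (fun t => t.hom g) (koszulComplex_d x X (i + 1))

end Koszul

end LocalHomology

/-! ### Koszul homology in top degree. -/

namespace LocalHomology

open localCohomology

variable {R : Type u} [CommRing R]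

section Top

variable {r : ℕ} {x : Fin r → R} {X M : Type u} [AddCommGroup X] [Module R X] [AddCommGroup M]
  [Module R M]

theorem eq_univ_of_card {r : ℕ} (S : {S : Finset (Fin r) // S.card = r}) :
    S.1 = Finset.univ :=
  (Finset.card_eq_iff_eq_univ S.1).1 (by simp [S.2])

omit [AddCommGroup X] in
theorem koszulX_top_apply {r : ℕ} (f : KoszulX r X r) (S : {S : Finset (Fin r) // S.card = r}) :
    f S = f ⟨Finset.univ, Finset.card_fin r⟩ :=
  congrArg f (Subtype.ext (eq_univ_of_card S))

theorem koszulD_apply {i : ℕ} (f : KoszulX r X (i + 1)) (S : {S : Finset (Fin r) // S.card = i}) :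
    koszulD x X i f S =
      ∑ s : {s // s ∉ S.1}, (koszulSign S.1 s.1 * x s.1) • f (insertIndex S s) :=
  rfl

/-- The coefficient of the boundary at the complement of `s` is the single term `± x s • f univ`. -/
theorem koszulD_top_eq_zero_iff {n : ℕ} {x : Fin (n + 1) → R} (f : KoszulX (n + 1) X (n + 1)) :
    koszulD x X n f = 0 ↔ ∀ s, x s • f ⟨Finset.univ, Finset.card_fin (n + 1)⟩ = 0 := by
  constructor
  · intro h s
    have hcard : (Finset.univ.erase s).card = n := by simp
    have h' := congrFun h ⟨Finset.univ.erase s, hcard⟩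
    let _ : Unique {t // t ∉ Finset.univ.erase s} :=
      { default := ⟨s, by simp⟩
        uniq := fun t => Subtype.ext (by simpa using t.2) }
    rw [koszulD_apply, Fintype.sum_unique, koszulX_top_apply f (insertIndex _ _)] at h'
    change (koszulSign (Finset.univ.erase s) s * x s) • _ = (0 : X) at h'
    rw [mul_smul, koszulSign] at h'
    rcases neg_one_pow_eq_or R ((Finset.univ.erase s).filter (· < s)).card with h₁ | h₁
    · rwa [h₁, one_smul] at h'
    · rwa [h₁, neg_smul, one_smul, neg_eq_zero] at h'
  · intro h
    funext S
    rw [koszulD_apply]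
    refine Finset.sum_eq_zero fun s _ => ?_
    rw [koszulX_top_apply f (insertIndex _ _), mul_smul, h, smul_zero]

/-- The constant Koszul chain in top degree. -/
def constChain (x : Fin r → R) (φ : M →ₗ[R] X) :
    ModuleCat.of R M ⟶ (koszulComplex x X).X r :=
  ModuleCat.ofHom (Y := KoszulX r X r) (LinearMap.pi fun _ => φ)

theorem constChain_d {φ : M →ₗ[R] X} (hφ : ∀ m s, x s • φ m = 0) (j : ℕ) :
    constChain x φ ≫ (koszulComplex x X).d r j = 0 := by
  by_cases h : j + 1 = r
  · subst h
    rw [koszulComplex_d]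
    refine ModuleCat.hom_ext (LinearMap.ext fun m => ?_)
    exact (koszulD_top_eq_zero_iff fun _ => φ m).2 (hφ m)
  · rw [(koszulComplex x X).shape r j h, comp_zero]

/-- The map from `M` to the top Koszul homology induced by a map from `M` to the elements
annihilated by `x`. -/
def toKoszulHomology {φ : M →ₗ[R] X} (hφ : ∀ m s, x s • φ m = 0) :
    ModuleCat.of R M ⟶ (koszulComplex x X).homology r :=
  (koszulComplex x X).liftCycles (constChain x φ) _ rfl (constChain_d hφ _) ≫
    (koszulComplex x X).homologyπ r

/-- No subset has `r + 1` elements, so there are no boundaries in degree `r`. -/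
theorem isIso_homologyπ_top : IsIso ((koszulComplex x X).homologyπ r) := by
  refine HomologicalComplex.isIso_homologyπ _ (r + 1) r (by simp) ?_
  refine IsZero.eq_of_src ?_ _ _
  have : IsEmpty {S : Finset (Fin r) // S.card = r + 1} :=
    ⟨fun S => by
      have := S.1.card_le_univ
      rw [S.2, Fintype.card_fin] at this
      omega⟩
  exact (ModuleCat.isZero_iff_subsingleton (M := ModuleCat.of R (KoszulX r X (r + 1)))).2
    inferInstance

theorem toKoszulHomology_eq_zero_iff {φ : M →ₗ[R] X} (hφ : ∀ m s, x s • φ m = 0) (m : M) :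
    toKoszulHomology hφ m = 0 ↔ φ m = 0 := by
  have h₁ : Function.Injective ((koszulComplex x X).homologyπ r) := by
    have := isIso_homologyπ_top (x := x) (X := X)
    exact (ModuleCat.mono_iff_injective _).1 inferInstance
  have h₂ : Function.Injective ((koszulComplex x X).iCycles r) :=
    (ModuleCat.mono_iff_injective _).1 inferInstance
  have h₃ : (koszulComplex x X).iCycles r ((koszulComplex x X).liftCycles (constChain x φ) _ rfl
      (constChain_d hφ _) m) = constChain x φ m :=
    congrArg (fun t => t.hom m) ((koszulComplex x X).liftCycles_i (constChain x φ) _ rfl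
      (constChain_d hφ _))
  change (koszulComplex x X).homologyπ r ((koszulComplex x X).liftCycles (constChain x φ) _ rfl
    (constChain_d hφ _) m) = 0 ↔ _
  rw [map_eq_zero_iff _ h₁, ← map_eq_zero_iff _ h₂, h₃]
  constructor
  · intro h
    exact congrFun h ⟨Finset.univ, Finset.card_fin r⟩
  · intro h
    exact funext fun _ => h

theorem toKoszulHomology_surjective {φ : M →ₗ[R] X} (hφ : ∀ m s, x s • φ m = 0)
    (hφ' : ∀ y : X, (∀ s, x s • y = 0) → ∃ m, φ m = y) :
    Function.Surjective (toKoszulHomology hφ) := by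
  intro c
  have h₁ : Function.Surjective ((koszulComplex x X).homologyπ r) :=
    (ModuleCat.epi_iff_surjective _).1 inferInstance
  have h₂ : Function.Injective ((koszulComplex x X).iCycles r) :=
    (ModuleCat.mono_iff_injective _).1 inferInstance
  obtain ⟨z, rfl⟩ := h₁ c
  let f : KoszulX r X r := (koszulComplex x X).iCycles r z
  obtain ⟨m, hm⟩ := hφ' (f ⟨Finset.univ, Finset.card_fin r⟩) (by
    obtain _ | n := r
    · exact fun s => s.elim0
    · refine (koszulD_top_eq_zero_iff f).1 ?_
      have h := congrArg (fun t => t.hom z) ((koszulComplex x X).iCycles_d (n + 1) n)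
      rw [koszulComplex_d] at h
      exact h)
  refine ⟨m, ?_⟩
  change (koszulComplex x X).homologyπ r ((koszulComplex x X).liftCycles (constChain x φ) _ rfl
    (constChain_d hφ _) m) = _
  congr 1
  apply h₂
  refine (congrArg (fun t => t.hom m) ((koszulComplex x X).liftCycles_i (constChain x φ) _ rfl
      (constChain_d hφ _))).trans ?_
  change (fun _ => φ m : KoszulX r X r) = f
  rw [hm]
  exact funext fun S => (koszulX_top_apply f S).symm

/-- The only subset in degree `r` is the full one, where the chain map scales by the whole product
of the `a s`. -/
theorem toKoszulHomology_koszulMap {y z a : Fin r → R} (h : ∀ s, z s = a s * y s)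
    {φ ψ : M →ₗ[R] X} (hφ : ∀ m s, z s • φ m = 0) (hψ : ∀ m s, y s • ψ m = 0)
    (hφψ : ∀ m, ψ m = (∏ s, a s) • φ m) :
    toKoszulHomology hφ ≫ HomologicalComplex.homologyMap (koszulMap X h) r =
      toKoszulHomology hψ := by
  have : constChain z φ ≫ (koszulMap X h).f r = constChain y ψ := by
    refine ModuleCat.hom_ext (LinearMap.ext fun m => ?_)
    change koszulScale X a r (fun _ => φ m) = (fun _ => ψ m : KoszulX r X r)
    funext S
    change (∏ s ∈ S.1, a s) • φ m = ψ m
    rw [eq_univ_of_card S, hφψ]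
  rw [toKoszulHomology, toKoszulHomology, Category.assoc, HomologicalComplex.homologyπ_naturality,
    HomologicalComplex.liftCycles_comp_cyclesMap_assoc]
  congr 2

end Top

end LocalHomology

/-! ### Adic completion as the limit of a cofinal system of quotients. -/

namespace LocalHomology

open Opposite

variable {R : Type u} [CommRing R] {M : Type u} [AddCommGroup M] [Module R M]

section Completion

variable {I : Ideal R} {F : ℕᵒᵖ ⥤ ModuleCat.{u} R} {p : ∀ n, ModuleCat.of R M ⟶ F.obj (op n)}

theorem map_of_succ (hp : ∀ n, p (n + 1) ≫ F.map (homOfLE (Nat.le_succ n)).op = p n) {k n : ℕ}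
    (h : k ≤ n) : p n ≫ F.map (homOfLE h).op = p k := by
  induction n, h using Nat.le_induction with
  | base => exact (congrArg (p k ≫ ·) (F.map_id _)).trans (Category.comp_id _)
  | succ n hn ih =>
    have : (homOfLE (Nat.le_succ_of_le hn)).op = (homOfLE (Nat.le_succ n)).op ≫ (homOfLE hn).op :=
      Subsingleton.elim _ _
    rw [this, F.map_comp, reassoc_of% (hp n), ih]

/-- An inverse system of quotients of `M` by submodules cofinal with the multiples of the powers
of `I` has the `I`-adic completion of `M` as its limit. -/
theorem nonempty_limit_iso_adicCompletion
    (hp : ∀ n, p (n + 1) ≫ F.map (homOfLE (Nat.le_succ n)).op = p n)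
    (hsurj : ∀ n, Function.Surjective (p n))
    (hle : ∀ n m, p n m = 0 → m ∈ I ^ n • (⊤ : Submodule R M))
    (hcof : ∀ n, ∃ k, ∀ m ∈ I ^ k • (⊤ : Submodule R M), p n m = 0) :
    Nonempty (limit F ≅ ModuleCat.of R (AdicCompletion I M)) := by
  choose c hc using hcof
  have hpm : ∀ {k n : ℕ} (h : k ≤ n) (m : M), F.map (homOfLE h).op (p n m) = p k m :=
    fun h m => congrArg (fun t => t.hom m) (map_of_succ hp h)
  have hpk : ∀ {k n : ℕ} (_ : k ≤ n) (m : M), p n m = 0 → p k m = 0 := fun h m hm => by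
    rw [← hpm h, hm, map_zero]
  let q : ∀ n, (M ⧸ I ^ c n • (⊤ : Submodule R M)) →ₗ[R] F.obj (op n) := fun n =>
    Submodule.liftQ _ (p n).hom fun m hm => hc n m hm
  let π : ∀ n, ModuleCat.of R (AdicCompletion I M) ⟶ F.obj (op n) := fun n =>
    ModuleCat.ofHom (q n ∘ₗ AdicCompletion.eval I M (c n))
  have hπ : ∀ n (z : AdicCompletion I M) (l : ℕ) (m : M), c n ≤ l →
      AdicCompletion.eval I M l z = Submodule.Quotient.mk m → π n z = p n m := by
    intro n z l m hl h
    have h' : AdicCompletion.eval I M (c n) z = Submodule.Quotient.mk m := by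
      rw [← AdicCompletion.transitionMap_comp_eval I M hl, LinearMap.comp_apply, h]
      rfl
    change q n (AdicCompletion.eval I M (c n) z) = _
    rw [h']
    rfl
  let s : Cone F :=
    { pt := ModuleCat.of R (AdicCompletion I M)
      π :=
        { app := fun n => π n.unop
          naturality := fun n k f => by
            refine (Category.id_comp _).trans ?_
            refine ModuleCat.hom_ext (LinearMap.ext fun z => ?_)
            let l := max (c n.unop) (c k.unop)
            obtain ⟨m, hm⟩ := Submodule.Quotient.mk_surjective _ (AdicCompletion.eval I M l z)
            change π k.unop z = F.map f (π n.unop z)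
            rw [hπ _ z l m (le_max_right _ _) hm.symm, hπ _ z l m (le_max_left _ _) hm.symm]
            exact (hpm (leOfHom f.unop) m).symm } }
  have hs : IsIso (limit.lift F s) := by
    rw [ConcreteCategory.isIso_iff_bijective]
    have hlift : ∀ (z : AdicCompletion I M) n, limit.π F (op n) (limit.lift F s z) = π n z :=
      fun z n => congrArg (fun t => t.hom z) (limit.lift_π s (op n))
    constructor
    · refine (injective_iff_map_eq_zero _).2 fun z hz => ?_
      refine AdicCompletion.ext fun n => ?_
      have h₀ : π n z = 0 := by rw [← hlift, hz, map_zero]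
      -- Large enough both to compute `π n z` from a representative and to determine `z` modulo `I ^
      -- n`.
      let l := max (c n) n
      obtain ⟨m, hm⟩ := Submodule.Quotient.mk_surjective _ (AdicCompletion.eval I M l z)
      rw [hπ n z l m (le_max_left _ _) hm.symm] at h₀
      have : AdicCompletion.eval I M n z = 0 := by
        rw [← AdicCompletion.transitionMap_comp_eval I M (le_max_right (c n) n),
          LinearMap.comp_apply, ← hm]
        exact (Submodule.Quotient.mk_eq_zero _).2 (hle n m h₀)
      exact this
    · intro y
      -- The lifts are chosen independently; `m n` and `m k` differ by an element of the kernel of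
      -- `p k`, hence agree modulo `I ^ k`.
      choose m hm using fun n => hsurj n (limit.π F (op n) y)
      have hcompat : ∀ {k n : ℕ} (h : k ≤ n), p k (m n - m k) = 0 := by
        intro k n h
        rw [map_sub, hm, ← hpm h, hm, sub_eq_zero]
        exact congrArg (fun t => t.hom y) (limit.w F (homOfLE h).op)
      let z : AdicCompletion I M := ⟨fun n => Submodule.Quotient.mk (m n), fun {k n} h => by
        change Submodule.Quotient.mk (m n) = Submodule.Quotient.mk (m k)
        rw [Submodule.Quotient.eq]
        exact hle k _ (hcompat h)⟩
      refine ⟨z, Concrete.limit_ext F _ _ fun n => ?_⟩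
      rw [hlift z n.unop, hπ n.unop z (max (c n.unop) n.unop) (m _) (le_max_left _ _) rfl]
      refine Eq.trans ?_ (hm n.unop)
      rw [← sub_eq_zero, ← map_sub]
      exact hcompat (le_max_right _ _)
  exact ⟨(asIso (limit.lift F s)).symm⟩

end Completion

end LocalHomology

/-! ### Assembly of the theorem. -/

namespace LocalHomology

open Opposite localCohomology IsLocalRing

variable {R : Type u} [CommRing R]

theorem isZero_localHomology {r : ℕ} {x : Fin r → R} {X : Type u} [AddCommGroup X] [Module R X]
    {i : ℕ} (h : ∀ n, IsZero ((koszulComplex (fun s => x s ^ (n + 1)) X).homology i)) :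
    IsZero (localHomology x X i) := by
  rw [ModuleCat.isZero_iff_subsingleton]
  refine ⟨fun a b => Concrete.limit_ext (koszulHomologySystem x X i) a b fun n => ?_⟩
  have : Subsingleton ((koszulHomologySystem x X i).obj n) :=
    ModuleCat.subsingleton_of_isZero (h n.unop)
  exact Subsingleton.elim _ _

theorem isZero_koszulHomology_of_subsingleton {r : ℕ} (x : Fin r → R) (X : Type u) [AddCommGroup X]
    [Module R X] [Subsingleton X] (i : ℕ) : IsZero ((koszulComplex x X).homology i) := by
  rw [← HomologicalComplex.exactAt_iff_isZero_homology]
  exact ShortComplex.exact_of_isZero_X₂ _ ((ModuleCat.isZero_iff_subsingleton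
    (M := ModuleCat.of R (KoszulX r X i))).2 inferInstance)

/-- The supremum need not be attained, but for finite `d` it suffices: if all lengths were below
`d`, so would be their supremum. -/
theorem exists_isRegular_of_le_depth [IsLocalRing R] {M : Type u} [AddCommGroup M] [Module R M]
    {d : ℕ} [Nontrivial M] (h : d ≤ depth R M) :
    ∃ rs : List R, (∀ r ∈ rs, r ∈ maximalIdeal R) ∧ RingTheory.Sequence.IsRegular M rs ∧
      d ≤ rs.length := by
  obtain _ | d := d
  · exact ⟨[], by simp, RingTheory.Sequence.IsRegular.nil R M, le_rfl⟩
  · by_contra! hc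
    have : depth R M ≤ d := iSup_le fun rs => by
      have := hc rs.1 rs.2.1 rs.2.2
      exact_mod_cast Nat.lt_succ_iff.1 this
    have := h.trans this
    norm_cast at this
    omega

theorem koszulHomologySystem_map_succ {r : ℕ} (x : Fin r → R) (X : Type u) [AddCommGroup X]
    [Module R X] (i n : ℕ) :
    (koszulHomologySystem x X i).map (homOfLE (Nat.le_succ n)).op =
      HomologicalComplex.homologyMap (koszulMap X (y := fun s => x s ^ (n + 1))
        (z := fun s => x s ^ (n + 1 + 1)) (a := x) (fun s => pow_succ' (x s) (n + 1))) i :=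
  Functor.ofOpSequence_map_homOfLE_succ _ n

end LocalHomology

end

open LocalHomology localCohomology IsLocalRing in
theorem theorem3p1 {R : Type u} [CommRing R] [IsNoetherianRing R] [IsLocalRing R]
    {M : Type u} [AddCommGroup M] [Module R M] [Module.Finite R M]
    {d : ℕ} (hd : Module.supportDim R M = d) (hM : LocalHomology.IsCohenMacaulay R M)
    (x : Fin d → R) (hx : LocalHomology.IsSystemOfParameters M x) :
    Nonempty (LocalHomology.localHomology x
        ((localCohomology (IsLocalRing.maximalIdeal R) d).obj (ModuleCat.of R M)) d ≅
      ModuleCat.of R (AdicCompletion (IsLocalRing.maximalIdeal R) M)) ∧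
    ∀ i j : ℕ, ¬ (i = d ∧ j = d) →
      IsZero (LocalHomology.localHomology x
        ((localCohomology (IsLocalRing.maximalIdeal R) j).obj (ModuleCat.of R M)) i) := by
  have hnt : Nontrivial M := by
    rw [← Module.supportDim_ne_bot_iff_nontrivial R, hd]
    exact WithBot.coe_ne_bot
  have hdepth : (d : ℕ∞) ≤ depth R M := by
    have h := (hM.resolve_left (not_subsingleton M)).trans hd
    exact le_of_eq (WithBot.coe_injective h).symm
  obtain ⟨rs, hrs, hreg, hlen⟩ := exists_isRegular_of_le_depth hdepth
  have hvan : ∀ j < d, IsZero ((localCohomology (maximalIdeal R) j).obj (ModuleCat.of R M)) :=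
    fun j hj => isZero_of_isWeaklyRegular hrs hreg.toIsWeaklyRegular (hj.trans_le hlen)
  have hpar : IsParameterSystem x M := by
    obtain ⟨k, hk⟩ := exists_pow_maximalIdeal_smul_eq_zero_of_isFiniteLength hx.isFiniteLength
    exact isParameterSystem_of_isPowTorsion fun m => ⟨k, fun a ha => hk a ha m⟩
  -- The exponent `n + 1` matches the indexing of `koszulHomologySystem`.
  let y : ℕ → Fin d → R := fun n s => x s ^ (n + 1)
  have hy : ∀ n s, y n s ∈ maximalIdeal R ^ (n + 1) := fun n s =>
    Ideal.pow_mem_pow (hx.mem_maximalIdeal s) (n + 1)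
  have hy' : ∀ n s, y n s ∈ maximalIdeal R := fun n s =>
    Ideal.pow_le_self n.succ_ne_zero (hy n s)
  have hyreg : ∀ n, IsRegularSequence (y n) (ModuleCat.of R M) := fun n =>
    isRegularSequence_of_isParameterSystem (hy' n) (ModuleCat.of R M) (hpar.pow (n + 1)) hvan
  have hypow := fun n => exists_pow_maximalIdeal_smul_eq_zero (hpar.pow (n + 1))
  have hytor : ∀ n, IsPowTorsion (maximalIdeal R)
      (M ⧸ Ideal.span (Set.range (y n)) • (⊤ : Submodule R M)) := fun n m => by
    obtain ⟨k, hk⟩ := hypow n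
    exact ⟨k, fun a ha => hk a ha m⟩
  have hspec := fun n => toTop_spec (hy' n) (hyreg n) (hytor n)
  constructor
  · let H := (localCohomology (maximalIdeal R) d).obj (ModuleCat.of R M)
    let φ : ∀ n, M →ₗ[R] H := fun n => toTop (maximalIdeal R) (y n) (ModuleCat.of R M)
    have hφ : ∀ n m s, y n s • φ n m = 0 := fun n m => ((hspec n).2.2.2 (φ n m)).2 ⟨m, rfl⟩
    refine nonempty_limit_iso_adicCompletion (F := koszulHomologySystem x H d)
      (p := fun n => toKoszulHomology (hφ n)) (fun n => ?_) (fun n => ?_) (fun n m hm => ?_)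
      fun n => ?_
    · rw [koszulHomologySystem_map_succ]
      refine toKoszulHomology_koszulMap _ (hφ (n + 1)) (hφ n) fun m => ?_
      -- Applied to the identity of `M`: the transition map then corresponds to the projection
      -- between quotients of `M`.
      have := toTop_naturality (J := maximalIdeal R) (x := y n) (y := y (n + 1)) (a := x)
        (fun s => pow_succ' (x s) (n + 1)) (𝟙 (ModuleCat.of R M)) (hyreg (n + 1)) (hyreg n)
        (hytor (n + 1)) (hytor n) m
      rw [CategoryTheory.Functor.map_id] at this
      exact this
    · exact toKoszulHomology_surjective (hφ n) fun c => ((hspec n).2.2.2 c).1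
    -- The kernel at `n` is generated by `(n + 1)`-st powers, so it lies in `𝔪ⁿ⁺¹M`, more than is
    -- needed.
    · refine Submodule.smul_mono_left (Ideal.span_le.2 ?_)
        (((hspec n).2.2.1 m).1 ((toKoszulHomology_eq_zero_iff (hφ n) m).1 hm))
      rintro _ ⟨s, rfl⟩
      exact Ideal.pow_le_pow_right n.le_succ (hy n s)
    · obtain ⟨k, hk⟩ := hypow n
      refine ⟨k, fun m hm => (toKoszulHomology_eq_zero_iff (hφ n) m).2
        (((hspec n).2.2.1 m).2 ?_)⟩
      have hle : maximalIdeal R ^ k • (⊤ : Submodule R M) ≤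
          Ideal.span (Set.range (y n)) • (⊤ : Submodule R M) :=
        Submodule.smul_le.2 fun a ha m _ => (Submodule.Quotient.mk_eq_zero _).1
          (hk a ha (Submodule.Quotient.mk m))
      exact hle hm
  · intro i j hij
    by_cases hj : j = d
    · subst hj
      exact isZero_localHomology fun n =>
        isZero_koszulHomology (hspec n).2.1 fun hi => hij ⟨hi, rfl⟩
    -- Here `H^j(M)` itself vanishes; any exponent would do to see it, and `0` stands for `x` to the
    -- first power.
    · have := ModuleCat.subsingleton_of_isZero ((hspec 0).1 j hj)
      exact isZero_localHomology fun n => isZero_koszulHomology_of_subsingleton _ _ i
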